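/- Let $\mathbb D$ be the unit disc, $f:\mathbb D\to\mathbb D$ an analytic mapping, and let $\sigma$ be an Aleksandrov--Clark measure of $f$, that is, a finite positive Borel measure on $\partial\mathbb D$ such that, for some $\alpha\in\partial\mathbb D$ and some $C\in\mathbb R$, $$\frac{\alpha+f(z)}{\alpha-f(z)}=\int_{\partial\mathbb D}\frac{\xi+z}{\xi-z}\,d\sigma(\xi)+iC,\qquad z\in\mathbb D.$$ Let $$u(z)=\int_{\partial\mathbb D}\frac{1-|z|^2}{|\xi-z|^2}\,d\sigma(\xi),\qquad z\in\mathbb D,$$ be its Poisson integral. For an arc $I\subset\partial\mathbb D$ let $|I|\in(0,1]$ be its normalized length (so $|\partial\mathbb D|=1$), $\xi_I$ its center, $z_I=(1-|I|)\xi_I$, and $Q(I)=\{z\in\mathbb D:\ 1-|z|\le|I|,\ z/|z|\in I\}$ its Carleson box; let $A$ be normalized area measure on $\mathbb D$. The following conditions are equivalent: (a) $f$ is contractive, that is, $$\sup_{z\in\mathbb D}\frac{(1-|z|^2)|f'(z)|}{1-|f(z)|^2}<1.$$ (b) There is a constant $c>0$ such that $\dfrac{\sigma(I)}{|I|}\ge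 c\,u(z_I)$ for every arc $I\subset\partial\mathbb D$. (c) $u$ is a Bekollé--Bonami $B_2$ weight, that is, $$\sup_{Q}\left(\frac1{A(Q)}\int_Q u\,dA\right)\left(\frac1{A(Q)}\int_Q\frac{dA}{u}\right)<\infty,$$ where the supremum is taken over all Carleson boxes $Q=Q(I)$. -/

import Mathlib

open MeasureTheory Metric
open scoped ENNReal

noncomputable section

/-- The unit circle carries its Borel sigma-algebra. -/
instance instMeasurableSpaceUnitCircle : MeasurableSpace Circle := borel Circle

instance instBorelSpaceUnitCircle : BorelSpace Circle := ⟨rfl⟩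

/-- The hyperbolic derivative `(1 - |z|²) |f'(z)| / (1 - |f(z)|²)` of a self-map of the disc. -/
def hyperbolicDeriv (f : ℂ → ℂ) (z : ℂ) : ℝ :=
  (1 - ‖z‖ ^ 2) * ‖deriv f z‖ / (1 - ‖f z‖ ^ 2)

/-- `f` is contractive: the supremum over the unit disc of its hyperbolic derivative is `< 1`. -/
def IsContractive (f : ℂ → ℂ) : Prop :=
  ∃ D : ℝ, D < 1 ∧ ∀ z ∈ ball (0 : ℂ) 1, hyperbolicDeriv f z ≤ D

/-- `σ` is one of the Aleksandrov-Clark measures of `f`: a finite positive Borel measure on the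
unit circle such that, for some `α` on the circle and some real constant `C`, the function
`(α + f) / (α - f)` is the Herglotz integral of `σ` plus `i C` in the unit disc. -/
def IsAleksandrovClarkMeasure (f : ℂ → ℂ) (σ : Measure Circle) : Prop :=
  IsFiniteMeasure σ ∧ ∃ α : Circle, ∃ C : ℝ, ∀ z ∈ ball (0 : ℂ) 1,
    ((α : ℂ) + f z) / ((α : ℂ) - f z) =
      (∫ ξ : Circle, ((ξ : ℂ) + z) / ((ξ : ℂ) - z) ∂σ) + Complex.I * (C : ℂ)

/-- The Poisson integral of a measure on the unit circle. -/
def poissonIntegral (σ : Measure Circle) (z : ℂ) : ℝ :=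
  ∫ ξ : Circle, (1 - ‖z‖ ^ 2) / ‖(ξ : ℂ) - z‖ ^ 2 ∂σ

/-- The open arc with centre `ξ` and normalized length `l` (the whole circle has length `1`). -/
def openArc (ξ : Circle) (l : ℝ) : Set Circle :=
  (fun t : ℝ => ξ * Circle.exp (2 * Real.pi * t)) '' Set.Ioo (-(l / 2)) (l / 2)

/-- The closed arc with centre `ξ` and normalized length `l`. -/
def closedArc (ξ : Circle) (l : ℝ) : Set Circle :=
  (fun t : ℝ => ξ * Circle.exp (2 * Real.pi * t)) '' Set.Icc (-(l / 2)) (l / 2)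

/-- `I` is an arc (open, closed or half-open) of the unit circle with centre `ξ` and normalized
length `l`, where `0 < l ≤ 1`. The whole circle is an arc of length `1`, with any centre. -/
def IsArc (I : Set Circle) (ξ : Circle) (l : ℝ) : Prop :=
  0 < l ∧ l ≤ 1 ∧ openArc ξ l ⊆ I ∧ I ⊆ closedArc ξ l

/-- The Carleson box `{z : |z| < 1, 1 - |z| ≤ l, z / |z| ∈ I}` over an arc `I` of length `l`.
The origin is never in it, since `0 / 0 = 0` is not on the circle. -/
def carlesonBox (I : Set Circle) (l : ℝ) : Set ℂ :=
  {z : ℂ | ‖z‖ < 1 ∧ 1 - ‖z‖ ≤ l ∧ ∃ ζ ∈ I, (ζ : ℂ) = z / (‖z‖ : ℂ)}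

/-- Normalized Lebesgue measure on the unit disc. -/
def discArea : Measure ℂ :=
  (volume (ball (0 : ℂ) 1))⁻¹ • volume.restrict (ball (0 : ℂ) 1)

/-- The Bekollé-Bonami characteristic `[w]_{B_2}` of a positive function `w` on the disc: the
supremum over all Carleson boxes of the product of the averages of `w` and of `1 / w`. -/
def bekolleBonamiB2 (w : ℂ → ℝ) : ℝ≥0∞ :=
  ⨆ (I : Set Circle) (ξ : Circle) (l : ℝ) (_ : IsArc I ξ l),
    ((discArea (carlesonBox I l))⁻¹ * ∫⁻ z in carlesonBox I l, ENNReal.ofReal (w z) ∂discArea) *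
    ((discArea (carlesonBox I l))⁻¹ * ∫⁻ z in carlesonBox I l, ENNReal.ofReal (1 / w z) ∂discArea)

end

/-! Let `H` be the Herglotz integral of `σ` and `u = Re H`. Since `H` is a Cayley transform of `f`
up to an imaginary constant, the hyperbolic derivative of `f` at `z` is `(1 - |z|²)|H'(z)| /
(2u(z))`. Moreover `(1 - |z|²) H'(z) = 2 ∫ P_z φ_z dσ` with `P_z` the Poisson kernel and `φ_z`
unimodular, so the hyperbolic derivative equals `|∫ P_z φ_z dσ| / ∫ P_z dσ`, and contractivity is a
uniform gap in the triangle inequality. The equivalence is proved as the cycle (a) ⇒ (c) ⇒ (b) ⇒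
(a).

(b) ⇒ (a), `isContractive_of_arc_le`: by (b), two arcs near `z/|z|`, one on each side, both carry a
fixed fraction of `∫ P_z dσ`. The phase `φ_z` takes well separated values on them, so cancellation
is unavoidable (`norm_integral_mul_le_sub`).

(a) ⇒ (c), `bekolleBonamiB2_lt_top_of_isContractive`: the bound `D < 1` on the hyperbolic derivative
makes `log u` Lipschitz with constant `D` along radii for the hyperbolic metric. Over a box of size
`l`, both `u / u(z_I)` and `u(z_I) / u` are thus at most a constant times `(l / (1 - r))^D`, which
is integrable in `r` because `D < 1`.

(c) ⇒ (b), `exists_arc_le_of_bekolleBonamiB2_lt_top`: if `σ(I)` is at most `ε |I| u(z_I)`, then at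
radius `r` the angular mean of `u` over a middle portion of the box is at most a constant times
`u(z_I) (ε + (1 - r)/l)`. Jensen's inequality bounds the mean of `1/u` from below, and integration
in `r` produces `log (1 + 1/(2ε)) / u(z_I)`. The mean of `u` is at least a multiple of `u(z_I)`, so
a finite `B_2` characteristic keeps `ε` away from zero. -/

/-! ### Poisson kernel and Harnack-type comparisons -/

/-- The Poisson kernel of the unit disc, as a function of a point of the disc and a point of the
circle. -/
noncomputable def circlePoissonKernel (z : ℂ) (ξ : Circle) : ℝ :=
  (1 - ‖z‖ ^ 2) / ‖(ξ : ℂ) - z‖ ^ 2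

lemma poissonIntegral_eq (σ : Measure Circle) (z : ℂ) :
    poissonIntegral σ z = ∫ ξ, circlePoissonKernel z ξ ∂σ := rfl

lemma one_sub_norm_le_norm_circle_sub (z : ℂ) (ξ : Circle) : 1 - ‖z‖ ≤ ‖(ξ : ℂ) - z‖ := by
  simpa only [Circle.norm_coe] using norm_sub_norm_le (ξ : ℂ) z

lemma norm_circle_sub_pos {z : ℂ} (hz : ‖z‖ < 1) (ξ : Circle) : 0 < ‖(ξ : ℂ) - z‖ := by
  linarith [one_sub_norm_le_norm_circle_sub z ξ]

lemma circle_sub_ne_zero {z : ℂ} (hz : ‖z‖ < 1) (ξ : Circle) : (ξ : ℂ) - z ≠ 0 :=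
  norm_pos_iff.1 (norm_circle_sub_pos hz ξ)

lemma one_sub_norm_sq_pos {z : ℂ} (hz : ‖z‖ < 1) : 0 < 1 - ‖z‖ ^ 2 := by
  nlinarith [norm_nonneg z]

lemma circlePoissonKernel_pos {z : ℂ} (hz : ‖z‖ < 1) (ξ : Circle) :
    0 < circlePoissonKernel z ξ :=
  div_pos (one_sub_norm_sq_pos hz) (pow_pos (norm_circle_sub_pos hz ξ) 2)

lemma continuous_circlePoissonKernel {z : ℂ} (hz : ‖z‖ < 1) :
    Continuous (circlePoissonKernel z) := by
  unfold circlePoissonKernel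
  refine Continuous.div (by fun_prop) (by fun_prop) fun ξ ↦ ?_
  exact (pow_pos (norm_circle_sub_pos hz ξ) 2).ne'

lemma Continuous.integrable_of_circle {E : Type*} [NormedAddCommGroup E] (σ : Measure Circle)
    [IsFiniteMeasure σ] {g : Circle → E} (hg : Continuous g) : Integrable g σ :=
  hg.integrable_of_hasCompactSupport (HasCompactSupport.of_compactSpace g)

lemma integrable_circlePoissonKernel (σ : Measure Circle) [IsFiniteMeasure σ] {z : ℂ}
    (hz : ‖z‖ < 1) : Integrable (circlePoissonKernel z) σ :=
  (continuous_circlePoissonKernel hz).integrable_of_circle σ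

lemma ofReal_poissonIntegral (σ : Measure Circle) [IsFiniteMeasure σ] {z : ℂ} (hz : ‖z‖ < 1) :
    ENNReal.ofReal (poissonIntegral σ z) =
      ∫⁻ ξ, ENNReal.ofReal (circlePoissonKernel z ξ) ∂σ :=
  ofReal_integral_eq_lintegral_ofReal (integrable_circlePoissonKernel σ hz)
    (Filter.Eventually.of_forall fun ξ ↦ (circlePoissonKernel_pos hz ξ).le)

lemma circlePoissonKernel_le_mul {z w : ℂ} (hz : ‖z‖ < 1) (hw : ‖w‖ < 1) {K M : ℝ} (ξ : Circle)
    (hM : 1 - ‖z‖ ^ 2 ≤ M * (1 - ‖w‖ ^ 2)) (hK : ‖(ξ : ℂ) - w‖ ≤ K * ‖(ξ : ℂ) - z‖) :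
    circlePoissonKernel z ξ ≤ M * K ^ 2 * circlePoissonKernel w ξ := by
  have h1 := norm_circle_sub_pos hz ξ
  have h2 := norm_circle_sub_pos hw ξ
  have h3 := one_sub_norm_sq_pos hz
  unfold circlePoissonKernel
  rw [← mul_div_assoc, div_le_div_iff₀ (by positivity) (by positivity)]
  calc (1 - ‖z‖ ^ 2) * ‖(ξ : ℂ) - w‖ ^ 2
      ≤ (M * (1 - ‖w‖ ^ 2)) * (K * ‖(ξ : ℂ) - z‖) ^ 2 := by gcongr; linarith
    _ = _ := by ring

/-- Points at comparable height whose distance is at most a multiple of the height have comparable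
Poisson integrals. -/
lemma poissonIntegral_le_mul (σ : Measure Circle) [IsFiniteMeasure σ] {z w : ℂ} (hz : ‖z‖ < 1)
    (hw : ‖w‖ < 1) {K M : ℝ} (hM : 1 - ‖z‖ ^ 2 ≤ M * (1 - ‖w‖ ^ 2))
    (hK : ‖z - w‖ ≤ K * (1 - ‖z‖)) :
    poissonIntegral σ z ≤ M * (1 + K) ^ 2 * poissonIntegral σ w := by
  have hK0 : 0 ≤ K := nonneg_of_mul_nonneg_left ((norm_nonneg _).trans hK) (by linarith)
  rw [poissonIntegral_eq, poissonIntegral_eq, ← integral_const_mul]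
  refine integral_mono (integrable_circlePoissonKernel σ hz)
    ((integrable_circlePoissonKernel σ hw).const_mul _) fun ξ ↦ ?_
  refine circlePoissonKernel_le_mul hz hw ξ hM ?_
  have h1 := one_sub_norm_le_norm_circle_sub z ξ
  calc ‖(ξ : ℂ) - w‖ ≤ ‖(ξ : ℂ) - z‖ + ‖z - w‖ := norm_sub_le_norm_sub_add_norm_sub _ _ _
    _ ≤ ‖(ξ : ℂ) - z‖ + K * ‖(ξ : ℂ) - z‖ := by
        gcongr; exact hK.trans (mul_le_mul_of_nonneg_left h1 hK0)
    _ = _ := by ring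

/-! ### Herglotz integral and hyperbolic derivative -/

/-- The Herglotz integral of a measure on the unit circle. -/
noncomputable def herglotzIntegral (σ : Measure Circle) (z : ℂ) : ℂ :=
  ∫ ξ : Circle, ((ξ : ℂ) + z) / ((ξ : ℂ) - z) ∂σ

lemma re_add_div_sub (a b : ℂ) :
    ((a + b) / (a - b)).re = (‖a‖ ^ 2 - ‖b‖ ^ 2) / ‖a - b‖ ^ 2 := by
  rw [Complex.div_re, Complex.normSq_eq_norm_sq, ← add_div, ← Complex.normSq_eq_norm_sq a,
    ← Complex.normSq_eq_norm_sq b, Complex.normSq_apply, Complex.normSq_apply]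
  simp only [Complex.add_re, Complex.sub_re, Complex.add_im, Complex.sub_im]
  congr 1
  ring

lemma continuous_herglotzKernel {z : ℂ} (hz : ‖z‖ < 1) :
    Continuous fun ξ : Circle ↦ ((ξ : ℂ) + z) / ((ξ : ℂ) - z) :=
  Continuous.div (by fun_prop) (by fun_prop) (circle_sub_ne_zero hz)

lemma continuous_herglotzKernel_deriv {z : ℂ} (hz : ‖z‖ < 1) :
    Continuous fun ξ : Circle ↦ 2 * (ξ : ℂ) / ((ξ : ℂ) - z) ^ 2 :=
  Continuous.div (by fun_prop) (by fun_prop) fun ξ ↦ pow_ne_zero 2 (circle_sub_ne_zero hz ξ)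

lemma re_herglotzIntegral (σ : Measure Circle) [IsFiniteMeasure σ] {z : ℂ} (hz : ‖z‖ < 1) :
    (herglotzIntegral σ z).re = poissonIntegral σ z := by
  have h := integral_re (𝕜 := ℂ) ((continuous_herglotzKernel hz).integrable_of_circle σ)
  rw [herglotzIntegral, poissonIntegral]
  refine h.symm.trans (integral_congr_ae (Filter.Eventually.of_forall fun ξ ↦ ?_))
  have h2 := re_add_div_sub (ξ : ℂ) z
  rwa [Circle.norm_coe, one_pow] at h2

lemma hasDerivAt_herglotzIntegral (σ : Measure Circle) [IsFiniteMeasure σ] {z : ℂ}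
    (hz : ‖z‖ < 1) :
    HasDerivAt (herglotzIntegral σ) (∫ ξ : Circle, 2 * (ξ : ℂ) / ((ξ : ℂ) - z) ^ 2 ∂σ) z := by
  obtain ⟨r, hzr, hr1⟩ := exists_between hz
  have hs : ball (0 : ℂ) r ∈ nhds z := isOpen_ball.mem_nhds (by simpa using hzr)
  refine (hasDerivAt_integral_of_dominated_loc_of_deriv_le (bound := fun _ ↦ 2 / (1 - r) ^ 2)
    (F' := fun w (ξ : Circle) ↦ 2 * (ξ : ℂ) / ((ξ : ℂ) - w) ^ 2) hs ?_
    ((continuous_herglotzKernel hz).integrable_of_circle σ)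
    ((continuous_herglotzKernel_deriv hz).aestronglyMeasurable) ?_ (integrable_const _) ?_).2
  · filter_upwards [hs] with w hw
    exact (continuous_herglotzKernel ((by simpa using hw : ‖w‖ < r).trans hr1)).aestronglyMeasurable
  · refine Filter.Eventually.of_forall fun ξ w hw ↦ ?_
    have hw' : ‖w‖ < r := by simpa using hw
    have h1 := one_sub_norm_le_norm_circle_sub w ξ
    simp only [norm_div, norm_mul, norm_pow, Circle.norm_coe, Complex.norm_ofNat, mul_one]
    gcongr; linarith
  · refine Filter.Eventually.of_forall fun ξ w hw ↦ ?_
    have hw' : ‖w‖ < r := by simpa using hw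
    have h0 := circle_sub_ne_zero (hw'.trans hr1) ξ
    refine (((hasDerivAt_id w).const_add (ξ : ℂ)).div ((hasDerivAt_id w).const_sub (ξ : ℂ))
      h0).congr_deriv ?_
    simp only [id_eq]
    field_simp
    ring

/-- The data of an Aleksandrov-Clark measure that matter for the hyperbolic derivative: positivity
of the Poisson integral and the expression of the hyperbolic derivative by the Herglotz integral. -/
lemma IsAleksandrovClarkMeasure.pos_and_hyperbolicDeriv_eq {f : ℂ → ℂ}
    (hf : DifferentiableOn ℂ f (ball (0 : ℂ) 1))
    (hmaps : Set.MapsTo f (ball (0 : ℂ) 1) (ball (0 : ℂ) 1))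
    {σ : Measure Circle} (hσ : IsAleksandrovClarkMeasure f σ) {z : ℂ} (hz : ‖z‖ < 1) :
    0 < poissonIntegral σ z ∧ hyperbolicDeriv f z =
      (1 - ‖z‖ ^ 2) * ‖∫ ξ : Circle, 2 * (ξ : ℂ) / ((ξ : ℂ) - z) ^ 2 ∂σ‖ /
        (2 * poissonIntegral σ z) := by
  obtain ⟨hfin, α, C, hF⟩ := hσ
  have hzb : z ∈ ball (0 : ℂ) 1 := by simpa using hz
  have hfz : ‖f z‖ < 1 := by simpa using hmaps hzb
  have hα := circle_sub_ne_zero hfz α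
  have hαn := norm_circle_sub_pos hfz α
  have hre : poissonIntegral σ z = (1 - ‖f z‖ ^ 2) / ‖(α : ℂ) - f z‖ ^ 2 := by
    have h := congrArg Complex.re (hF z hzb)
    rw [re_add_div_sub, Complex.add_re, Circle.norm_coe] at h
    have h2 := re_herglotzIntegral σ hz
    rw [herglotzIntegral] at h2
    rw [h2] at h
    simpa using h.symm
  have hpos : 0 < 1 - ‖f z‖ ^ 2 := one_sub_norm_sq_pos hfz
  refine ⟨by rw [hre]; positivity, ?_⟩
  have hfd : HasDerivAt f (deriv f z) z :=
    (hf.differentiableAt (isOpen_ball.mem_nhds hzb)).hasDerivAt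
  -- Differentiating both sides of the Clark identity gives `H' = 2αf'/(α - f)²`; the factor `|α -
  -- f|²` then cancels against the one in `hre`.
  have h1 := (hfd.const_add (α : ℂ)).div (hfd.const_sub (α : ℂ)) hα
  have h2 := (hasDerivAt_herglotzIntegral σ hz).add_const (Complex.I * (C : ℂ))
  have h3 := h1.unique (h2.congr_of_eventuallyEq (by
    filter_upwards [isOpen_ball.mem_nhds hzb] with w hw using hF w hw))
  rw [← h3, hre, hyperbolicDeriv]
  have h4 : deriv f z * ((α : ℂ) - f z) - ((α : ℂ) + f z) * -deriv f z = 2 * α * deriv f z := by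
    ring
  rw [h4]
  simp only [norm_div, norm_mul, norm_pow, Circle.norm_coe, Complex.norm_ofNat, mul_one]
  field_simp

/-! ### Arcs and chords -/

lemma norm_circle_exp_sub_one_le (t : ℝ) : ‖(Circle.exp t : ℂ) - 1‖ ≤ |t| := by
  rw [Circle.coe_exp, mul_comm]
  simpa using Real.norm_exp_I_mul_ofReal_sub_one_le (x := t)

lemma norm_circle_mul_exp_sub_le (ξ : Circle) (t : ℝ) :
    ‖((ξ * Circle.exp t : Circle) : ℂ) - ξ‖ ≤ |t| := by
  have h : ((ξ * Circle.exp t : Circle) : ℂ) - ξ = ξ * ((Circle.exp t : ℂ) - 1) := by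
    push_cast; ring
  rw [h, norm_mul, Circle.norm_coe, one_mul]
  exact norm_circle_exp_sub_one_le t

lemma isCompact_closedArc (ξ : Circle) (l : ℝ) : IsCompact (closedArc ξ l) :=
  isCompact_Icc.image (by fun_prop)

lemma measurableSet_closedArc (ξ : Circle) (l : ℝ) : MeasurableSet (closedArc ξ l) :=
  (isCompact_closedArc ξ l).isClosed.measurableSet

lemma openArc_subset_closedArc (ξ : Circle) (l : ℝ) : openArc ξ l ⊆ closedArc ξ l :=
  Set.image_mono Set.Ioo_subset_Icc_self

lemma isArc_closedArc {l : ℝ} (ξ : Circle) (h0 : 0 < l) (h1 : l ≤ 1) :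
    IsArc (closedArc ξ l) ξ l :=
  ⟨h0, h1, openArc_subset_closedArc ξ l, subset_rfl⟩

lemma exists_eq_mul_exp_of_mem_closedArc {ξ ζ : Circle} {l : ℝ} (h : ζ ∈ closedArc ξ l) :
    ∃ t : ℝ, |t| ≤ Real.pi * l ∧ ζ = ξ * Circle.exp t := by
  obtain ⟨t, ht, rfl⟩ := h
  refine ⟨2 * Real.pi * t, ?_, rfl⟩
  have h2 : |t| ≤ l / 2 := abs_le.2 ht
  rw [abs_mul, abs_of_pos Real.two_pi_pos]
  nlinarith [Real.pi_pos]

lemma mul_exp_mem_closedArc {ξ : Circle} {l t : ℝ} (ht : |t| ≤ Real.pi * l) :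
    ξ * Circle.exp t ∈ closedArc ξ l := by
  have hp := Real.pi_pos
  refine ⟨t / (2 * Real.pi), abs_le.1 ?_, ?_⟩
  · rw [abs_div, abs_of_pos Real.two_pi_pos, div_le_iff₀ Real.two_pi_pos]
    linarith
  · simp only
    congr 2
    field_simp

lemma exists_circle_mul_norm (z : ℂ) : ∃ ξ : Circle, z = (‖z‖ : ℂ) * ξ := by
  refine ⟨Circle.exp z.arg, ?_⟩
  rw [Circle.coe_exp]
  exact (Complex.norm_mul_exp_arg_mul_I z).symm

lemma norm_ofReal_mul_circle {r : ℝ} (hr : 0 ≤ r) (ξ : Circle) : ‖(r : ℂ) * ξ‖ = r := by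
  rw [norm_mul, Circle.norm_coe, mul_one, Complex.norm_real, Real.norm_of_nonneg hr]

/-- Jordan's inequality: a chord is at least `2/π` times the arc it subtends. -/
lemma norm_exp_sub_exp_ge {s t : ℝ} (hst : s ≤ t) (h : t - s ≤ Real.pi) :
    2 / Real.pi * (t - s) ≤ ‖(Circle.exp t : ℂ) - Circle.exp s‖ := by
  have h1 := Complex.mul_angle_le_norm_sub (Circle.norm_coe (Circle.exp t))
    (Circle.norm_coe (Circle.exp s))
  refine le_trans (mul_le_mul_of_nonneg_left ?_ (by positivity)) h1
  rw [Circle.coe_exp, Circle.coe_exp, Complex.angle_exp_exp,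
    (toIocMod_eq_self _).2 ⟨by linarith [Real.pi_pos], by linarith⟩]
  exact le_abs_self _

/-! ### The phase of the kernel, and (b) ⇒ (a) -/

/-- The unimodular factor of `(1 - |z|²) ξ / (ξ - z)²` relative to the Poisson kernel. -/
noncomputable def poissonPhase (z : ℂ) (ξ : Circle) : ℂ :=
  (ξ : ℂ) * ‖(ξ : ℂ) - z‖ ^ 2 / ((ξ : ℂ) - z) ^ 2

lemma norm_poissonPhase {z : ℂ} (hz : ‖z‖ < 1) (ξ : Circle) : ‖poissonPhase z ξ‖ = 1 := by
  have h := norm_circle_sub_pos hz ξ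
  simp only [poissonPhase, norm_div, norm_mul, norm_pow, Circle.norm_coe, Complex.norm_real,
    Real.norm_eq_abs, abs_norm, one_mul]
  field_simp

lemma continuous_poissonPhase {z : ℂ} (hz : ‖z‖ < 1) : Continuous (poissonPhase z) :=
  Continuous.div (by fun_prop) (by fun_prop) fun ξ ↦ pow_ne_zero 2 (circle_sub_ne_zero hz ξ)

/-- The phase is a Möbius map of `ξ`, the reciprocal of a Blaschke factor up to sign. This makes
differences of phases explicit in `norm_poissonPhase_sub`. -/
lemma poissonPhase_eq {z : ℂ} (hz : ‖z‖ < 1) (ξ : Circle) :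
    poissonPhase z ξ = (1 - starRingEnd ℂ z * ξ) / ((ξ : ℂ) - z) := by
  have h := circle_sub_ne_zero hz ξ
  have h1 : (ξ : ℂ) * starRingEnd ℂ (ξ : ℂ) = 1 := by
    rw [Complex.mul_conj, Complex.normSq_eq_norm_sq, Circle.norm_coe]; simp
  rw [poissonPhase, ← Complex.mul_conj', div_eq_div_iff (pow_ne_zero 2 h) h, map_sub]
  linear_combination ((ξ : ℂ) - z) ^ 2 * h1

lemma norm_poissonPhase_sub {z : ℂ} (hz : ‖z‖ < 1) (ξ η : Circle) :
    ‖poissonPhase z ξ - poissonPhase z η‖ =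
      (1 - ‖z‖ ^ 2) * ‖(ξ : ℂ) - η‖ / (‖(ξ : ℂ) - z‖ * ‖(η : ℂ) - z‖) := by
  have h1 := circle_sub_ne_zero hz ξ
  have h2 := circle_sub_ne_zero hz η
  rw [poissonPhase_eq hz, poissonPhase_eq hz, div_sub_div _ _ h1 h2, norm_div, norm_mul]
  congr 1
  have h3 : (1 - starRingEnd ℂ z * ξ) * ((η : ℂ) - z) - ((ξ : ℂ) - z) * (1 - starRingEnd ℂ z * η)
      = ((1 - ‖z‖ ^ 2 : ℝ) : ℂ) * ((η : ℂ) - ξ) := by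
    have h4 := Complex.conj_mul' z
    push_cast
    rw [← h4]
    ring
  rw [h3, norm_mul, Complex.norm_real, Real.norm_of_nonneg (one_sub_norm_sq_pos hz).le,
    norm_sub_rev]

lemma norm_integral_deriv_eq (σ : Measure Circle) {z : ℂ} (hz : ‖z‖ < 1) :
    (1 - ‖z‖ ^ 2) * ‖∫ ξ : Circle, 2 * (ξ : ℂ) / ((ξ : ℂ) - z) ^ 2 ∂σ‖ =
      2 * ‖∫ ξ : Circle, (circlePoissonKernel z ξ : ℂ) * poissonPhase z ξ ∂σ‖ := by
  have h1 : ∀ ξ : Circle, (circlePoissonKernel z ξ : ℂ) * poissonPhase z ξ =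
      (((1 - ‖z‖ ^ 2) / 2 : ℝ) : ℂ) * (2 * (ξ : ℂ) / ((ξ : ℂ) - z) ^ 2) := fun ξ ↦ by
    have h := circle_sub_ne_zero hz ξ
    have h' : (‖(ξ : ℂ) - z‖ : ℂ) ≠ 0 := by simpa using h
    simp only [circlePoissonKernel, poissonPhase]
    push_cast
    field_simp
  simp_rw [h1]
  rw [integral_const_mul, norm_mul, Complex.norm_real,
    Real.norm_of_nonneg (by linarith [one_sub_norm_sq_pos hz])]
  ring

/-- Quantitative strictness in the triangle inequality: if a unimodular function differs by at least
`2 η` between any two points of `J₁` and `J₂`, and both sets have mass at least `m`, then the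
integral falls short of the total mass by at least `η² / 2 * m`. -/
lemma norm_integral_mul_le_sub {σ : Measure Circle} {p : Circle → ℝ} {φ : Circle → ℂ}
    (hp : Integrable p σ) (hφc : Continuous φ) (hp0 : ∀ ξ, 0 ≤ p ξ) (hφ : ∀ ξ, ‖φ ξ‖ = 1)
    {J₁ J₂ : Set Circle} (hJ₁ : MeasurableSet J₁) (hJ₂ : MeasurableSet J₂) {η m : ℝ}
    (hη : 0 ≤ η) (hm₁ : m ≤ ∫ ξ in J₁, p ξ ∂σ) (hm₂ : m ≤ ∫ ξ in J₂, p ξ ∂σ)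
    (hsep : ∀ ξ ∈ J₁, ∀ ζ ∈ J₂, 2 * η ≤ ‖φ ξ - φ ζ‖) :
    ‖∫ ξ, (p ξ : ℂ) * φ ξ ∂σ‖ ≤ (∫ ξ, p ξ ∂σ) - η ^ 2 / 2 * m := by
  set G := ∫ ξ, (p ξ : ℂ) * φ ξ ∂σ with hG
  have hint : Integrable (fun ξ ↦ (p ξ : ℂ) * φ ξ) σ :=
    hp.ofReal.mul_bdd (c := 1) hφc.aestronglyMeasurable
      (Filter.Eventually.of_forall fun ξ ↦ (hφ ξ).le)
  obtain ⟨ω, hω, hωG⟩ : ∃ ω : ℂ, ‖ω‖ = 1 ∧ ω * G = ‖G‖ := by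
    by_cases h0 : G = 0
    · exact ⟨1, by simp, by simp [h0]⟩
    · have h1 : (‖G‖ : ℂ) ≠ 0 := by simpa using h0
      refine ⟨starRingEnd ℂ G / ‖G‖, ?_, ?_⟩
      · simp [h0]
      · rw [div_mul_eq_mul_div, Complex.conj_mul']
        field_simp
  -- For unimodular `x`, `1 - Re x = |1 - x|²/2`. With `ω` rotating the integral onto the positive
  -- axis, the deficit in the triangle inequality becomes an integral of a nonnegative function.
  have hdef : ∀ ξ, p ξ - (ω * ((p ξ : ℂ) * φ ξ)).re = p ξ * (‖1 - ω * φ ξ‖ ^ 2 / 2) := fun ξ ↦ by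
    have h1 : ‖ω * φ ξ‖ = 1 := by rw [norm_mul, hω, hφ, one_mul]
    have h2 : ‖1 - ω * φ ξ‖ ^ 2 = 2 - 2 * (ω * φ ξ).re := by
      have h3 := h1
      rw [← sq_eq_sq₀ (norm_nonneg _) zero_le_one, ← Complex.normSq_eq_norm_sq,
        Complex.normSq_apply] at h3
      rw [← Complex.normSq_eq_norm_sq, Complex.normSq_apply]
      simp only [Complex.sub_re, Complex.sub_im, Complex.one_re, Complex.one_im]
      linarith
    have h4 : ω * ((p ξ : ℂ) * φ ξ) = (p ξ : ℂ) * (ω * φ ξ) := by ring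
    rw [h2, h4, Complex.re_ofReal_mul]
    ring
  have hint' : Integrable (fun ξ ↦ (ω * ((p ξ : ℂ) * φ ξ)).re) σ := (hint.const_mul ω).re
  have hid : (∫ ξ, p ξ ∂σ) - ‖G‖ = ∫ ξ, p ξ * (‖1 - ω * φ ξ‖ ^ 2 / 2) ∂σ := by
    simp_rw [← hdef]
    rw [integral_sub hp hint']
    congr 1
    have h1 := integral_re (𝕜 := ℂ) (hint.const_mul ω)
    rw [integral_const_mul, ← hG, hωG] at h1
    simpa using h1.symm
  have hnn : ∀ ξ, 0 ≤ p ξ * (‖1 - ω * φ ξ‖ ^ 2 / 2) := fun ξ ↦ by have := hp0 ξ; positivity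
  have hI : Integrable (fun ξ ↦ p ξ * (‖1 - ω * φ ξ‖ ^ 2 / 2)) σ := by
    simp_rw [← hdef]; exact hp.sub hint'
  have key : ∀ J : Set Circle, MeasurableSet J → m ≤ ∫ ξ in J, p ξ ∂σ →
      (∀ ξ ∈ J, η ≤ ‖1 - ω * φ ξ‖) → η ^ 2 / 2 * m ≤ ∫ ξ, p ξ * (‖1 - ω * φ ξ‖ ^ 2 / 2) ∂σ := by
    intro J hJ hm hJη
    calc η ^ 2 / 2 * m ≤ η ^ 2 / 2 * ∫ ξ in J, p ξ ∂σ := by gcongr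
      _ = ∫ ξ in J, η ^ 2 / 2 * p ξ ∂σ := (integral_const_mul _ _).symm
      _ ≤ ∫ ξ in J, p ξ * (‖1 - ω * φ ξ‖ ^ 2 / 2) ∂σ := by
          refine setIntegral_mono_on (hp.integrableOn.const_mul _) hI.integrableOn hJ fun ξ hξ ↦ ?_
          rw [mul_comm]
          have := hp0 ξ
          have := hJη ξ hξ
          gcongr
      _ ≤ _ := setIntegral_le_integral hI (Filter.Eventually.of_forall hnn)
  -- Either `ωφ` stays `η`-far from `1` on `J₁`, or it comes `η`-close at one point of `J₁`, and the
  -- separation then keeps it `η`-far on all of `J₂`.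
  by_cases hc : ∀ ξ ∈ J₁, η ≤ ‖1 - ω * φ ξ‖
  · linarith [key J₁ hJ₁ hm₁ hc]
  · push Not at hc
    obtain ⟨ξ, hξ, hξη⟩ := hc
    refine le_sub_comm.1 (hid ▸ key J₂ hJ₂ hm₂ fun ζ hζ ↦ ?_)
    have h1 := hsep ξ hξ ζ hζ
    have h2 : ‖φ ξ - φ ζ‖ = ‖(1 - ω * φ ζ) - (1 - ω * φ ξ)‖ := by
      rw [sub_sub_sub_cancel_left, ← mul_sub, norm_mul, hω, one_mul]
    have h3 := norm_sub_le (1 - ω * φ ζ) (1 - ω * φ ξ)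
    linarith

/-- If `σ` charges every arc at least as much as a multiple of the Poisson integral predicts, then
the hyperbolic derivative is bounded away from `1`. -/
lemma isContractive_of_arc_le {f : ℂ → ℂ} (hf : DifferentiableOn ℂ f (ball (0 : ℂ) 1))
    (hmaps : Set.MapsTo f (ball (0 : ℂ) 1) (ball (0 : ℂ) 1))
    {σ : Measure Circle} (hσ : IsAleksandrovClarkMeasure f σ) {c : ℝ} (hc : 0 < c)
    (h : ∀ (I : Set Circle) (ξ : Circle) (l : ℝ), IsArc I ξ l →
        c * poissonIntegral σ (((1 - l : ℝ) : ℂ) * (ξ : ℂ)) ≤ σ.real I / l) :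
    IsContractive f := by
  have := hσ.1
  have hpi := Real.pi_pos
  have hpi4 := Real.pi_lt_four
  -- Here `1/18` is half the phase separation `1/9`. The mass fraction is `c/(72 * 256)`: `72 = 8 *
  -- 9` from arcs of length `l/8` on which the kernel is at least `1/(9l)`, and `256 = 16 * (1 +
  -- 3)²` from comparing `u(z)` with `u` at the points `w` of the two arcs.
  refine ⟨1 - (1 / 18) ^ 2 / 2 * (c / (72 * 256)), by
    have : 0 < (1 / 18 : ℝ) ^ 2 / 2 * (c / (72 * 256)) := by positivity
    linarith, fun z hz ↦ ?_⟩
  have hz1 : ‖z‖ < 1 := by simpa using hz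
  obtain ⟨hu, hhyp⟩ := hσ.pos_and_hyperbolicDeriv_eq hf hmaps hz1
  rw [hhyp, norm_integral_deriv_eq σ hz1]
  rw [mul_div_mul_left _ _ two_ne_zero, div_le_iff₀ hu]
  obtain ⟨ξ₀, hξ₀⟩ := exists_circle_mul_norm z
  set l := 1 - ‖z‖ with hl
  have hl0 : 0 < l := by linarith
  have hl1 : l ≤ 1 := by linarith [norm_nonneg z]
  have hzl : ‖z‖ = 1 - l := by ring
  -- points of the arc of half-width `π l / 2`
  have hnear : ∀ β : ℝ, |β| ≤ Real.pi * l / 2 → ‖((ξ₀ * Circle.exp β : Circle) : ℂ) - z‖ ≤ 3 * l := by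
    intro β hβ
    have h1 := norm_circle_mul_exp_sub_le ξ₀ β
    have h2 : ‖(ξ₀ : ℂ) - z‖ = l := by
      have h3 : (ξ₀ : ℂ) - z = (l : ℂ) * ξ₀ := by
        conv_lhs => rw [hξ₀]
        rw [hl]; push_cast; ring
      rw [h3, norm_ofReal_mul_circle hl0.le]
    calc _ ≤ ‖((ξ₀ * Circle.exp β : Circle) : ℂ) - ξ₀‖ + ‖(ξ₀ : ℂ) - z‖ :=
          norm_sub_le_norm_sub_add_norm_sub _ _ _
      _ ≤ 3 * l := by nlinarith
  have hmem : ∀ a : ℝ, ∀ ξ ∈ closedArc (ξ₀ * Circle.exp a) (l / 8),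
      ∃ β : ℝ, |β - a| ≤ Real.pi * l / 8 ∧ ξ = ξ₀ * Circle.exp β := by
    intro a ξ hξ
    obtain ⟨t, ht, rfl⟩ := exists_eq_mul_exp_of_mem_closedArc hξ
    exact ⟨a + t, by rw [add_sub_cancel_left]; linarith, by rw [Circle.exp_add, mul_assoc]⟩
  have hmass : ∀ a : ℝ, |a| ≤ 3 * Real.pi * l / 8 → c / (72 * 256) * poissonIntegral σ z ≤
      ∫ ξ in closedArc (ξ₀ * Circle.exp a) (l / 8), circlePoissonKernel z ξ ∂σ := by
    intro a ha
    set J := closedArc (ξ₀ * Circle.exp a) (l / 8)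
    set w : ℂ := ((1 - l / 8 : ℝ) : ℂ) * ((ξ₀ * Circle.exp a : Circle) : ℂ) with hw
    have hwn : ‖w‖ = 1 - l / 8 := norm_ofReal_mul_circle (by linarith) _
    have hJ := h J (ξ₀ * Circle.exp a) (l / 8) (isArc_closedArc _ (by linarith) (by linarith))
    have hzw : ‖z - w‖ ≤ 3 * (1 - ‖z‖) := by
      have h1 := norm_circle_mul_exp_sub_le ξ₀ a
      have h2 : z - w = -((7 * l / 8 : ℝ) : ℂ) * ξ₀ -
          ((1 - l / 8 : ℝ) : ℂ) * (((ξ₀ * Circle.exp a : Circle) : ℂ) - ξ₀) := by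
        conv_lhs => rw [hξ₀, hzl]
        rw [hw]; push_cast; ring
      have h3 : ‖((1 - l / 8 : ℝ) : ℂ)‖ ≤ 1 := by
        rw [Complex.norm_real, Real.norm_of_nonneg (by linarith)]; linarith
      calc ‖z - w‖ ≤ ‖-((7 * l / 8 : ℝ) : ℂ) * ξ₀‖ +
            ‖((1 - l / 8 : ℝ) : ℂ) * (((ξ₀ * Circle.exp a : Circle) : ℂ) - ξ₀)‖ := by
            rw [h2]; exact norm_sub_le _ _
        _ ≤ 7 * l / 8 + 1 * |a| := by
            rw [neg_mul, norm_neg, norm_ofReal_mul_circle (by linarith), norm_mul]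
            gcongr
        _ ≤ 3 * (1 - ‖z‖) := by nlinarith
    have hcomp := poissonIntegral_le_mul σ (M := 16) hz1 (by linarith : ‖w‖ < 1)
      (by rw [hwn, hzl]; nlinarith) hzw
    have hlow : ∀ ξ ∈ J, 1 / (9 * l) ≤ circlePoissonKernel z ξ := by
      intro ξ hξ
      obtain ⟨β, hβ, rfl⟩ := hmem a ξ hξ
      have h1 := hnear β (by
        calc |β| = |(β - a) + a| := by ring_nf
          _ ≤ |β - a| + |a| := abs_add_le _ _
          _ ≤ _ := by linarith)
      have h2 := norm_circle_sub_pos hz1 (ξ₀ * Circle.exp β)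
      rw [circlePoissonKernel, div_le_div_iff₀ (by positivity) (by positivity), hzl, one_mul]
      calc _ ≤ (3 * l) ^ 2 := by gcongr
        _ ≤ _ := by nlinarith [mul_nonneg hl0.le (mul_nonneg hl0.le (sub_nonneg.2 hl1))]
    have hint : σ.real J * (1 / (9 * l)) ≤ ∫ ξ in J, circlePoissonKernel z ξ ∂σ := by
      calc σ.real J * (1 / (9 * l)) = ∫ ξ in J, 1 / (9 * l) ∂σ := by
            rw [setIntegral_const, smul_eq_mul]
        _ ≤ _ := setIntegral_mono_on (integrable_const _)
            (integrable_circlePoissonKernel σ hz1).integrableOn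
            (measurableSet_closedArc _ _) hlow
    refine le_trans ?_ hint
    rw [le_div_iff₀ (by linarith)] at hJ
    have h5 : c * poissonIntegral σ w / 72 ≤ σ.real J * (1 / (9 * l)) := by
      rw [mul_one_div, div_le_div_iff₀ (by norm_num) (by linarith)]
      linarith
    refine le_trans ?_ h5
    rw [le_div_iff₀ (by norm_num)]
    have := mul_le_mul_of_nonneg_left hcomp hc.le
    linarith
  have hpl : 0 ≤ 3 * Real.pi * l / 8 := by positivity
  -- The arcs centred at angles `±3πl/8` with half-width `πl/8` lie within angle `πl/2` of `ξ₀` and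
  -- are `πl/2` apart, hence at chordal distance at least `l`.
  have hmain := norm_integral_mul_le_sub (integrable_circlePoissonKernel σ hz1)
    (continuous_poissonPhase hz1) (fun ξ ↦ (circlePoissonKernel_pos hz1 ξ).le)
    (norm_poissonPhase hz1) (measurableSet_closedArc _ _) (measurableSet_closedArc _ _)
    (η := 1 / 18) (by norm_num) (hmass (3 * Real.pi * l / 8) (abs_of_nonneg hpl).le)
    (hmass (-(3 * Real.pi * l / 8)) (by rw [abs_neg, abs_of_nonneg hpl])) ?_
  · rw [← poissonIntegral_eq] at hmain
    linarith
  · intro ξ hξ ζ hζ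
    obtain ⟨β, hβ, rfl⟩ := hmem _ ξ hξ
    obtain ⟨γ, hγ, rfl⟩ := hmem _ ζ hζ
    rw [abs_le] at hβ hγ
    have hb1 := hnear β (abs_le.2 ⟨by linarith, by linarith⟩)
    have hb2 := hnear γ (abs_le.2 ⟨by linarith, by linarith⟩)
    have hd : l ≤ ‖((ξ₀ * Circle.exp β : Circle) : ℂ) - (ξ₀ * Circle.exp γ : Circle)‖ := by
      have h1 : ((ξ₀ * Circle.exp β : Circle) : ℂ) - (ξ₀ * Circle.exp γ : Circle) =
          ξ₀ * ((Circle.exp β : ℂ) - Circle.exp γ) := by push_cast; ring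
      rw [h1, norm_mul, Circle.norm_coe, one_mul]
      refine le_trans ?_ (norm_exp_sub_exp_ge (by linarith) (by nlinarith))
      rw [div_mul_eq_mul_div, le_div_iff₀ hpi]
      linarith
    have hn1 := norm_circle_sub_pos hz1 (ξ₀ * Circle.exp β)
    have hn2 := norm_circle_sub_pos hz1 (ξ₀ * Circle.exp γ)
    rw [norm_poissonPhase_sub hz1, le_div_iff₀ (by positivity), hzl]
    calc _ ≤ 2 * (1 / 18) * ((3 * l) * (3 * l)) := by gcongr
      _ = l * l := by ring
      _ ≤ _ := mul_le_mul (by nlinarith [mul_nonneg hl0.le (sub_nonneg.2 hl1)]) hd hl0.le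
          (by nlinarith [mul_nonneg hl0.le (sub_nonneg.2 hl1)])

/-! ### Carleson boxes in polar coordinates -/

lemma carlesonBox_subset_ball (I : Set Circle) (l : ℝ) : carlesonBox I l ⊆ ball (0 : ℂ) 1 :=
  fun z hz ↦ by simpa using hz.1

lemma carlesonBox_mono {I J : Set Circle} (h : I ⊆ J) (l : ℝ) :
    carlesonBox I l ⊆ carlesonBox J l :=
  fun _ ⟨h1, h2, ζ, hζ, h3⟩ ↦ ⟨h1, h2, ζ, h hζ, h3⟩

lemma discArea_restrict {Q : Set ℂ} (hQ : Q ⊆ ball (0 : ℂ) 1) :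
    discArea.restrict Q = (volume (ball (0 : ℂ) 1))⁻¹ • volume.restrict Q := by
  rw [discArea, Measure.restrict_smul, Measure.restrict_restrict' measurableSet_ball,
    Set.inter_eq_left.2 hQ]

/-- Averages over subsets of the disc do not depend on the normalization of area. -/
lemma discArea_average {Q : Set ℂ} (hQ : Q ⊆ ball (0 : ℂ) 1) (g : ℂ → ℝ≥0∞) :
    (discArea Q)⁻¹ * ∫⁻ z in Q, g z ∂discArea = (volume Q)⁻¹ * ∫⁻ z in Q, g z := by
  have h0 : volume (ball (0 : ℂ) 1) ≠ 0 := (measure_ball_pos volume _ one_pos).ne'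
  have h1 : volume (ball (0 : ℂ) 1) ≠ ⊤ := measure_ball_lt_top.ne
  have hv : discArea Q = (volume (ball (0 : ℂ) 1))⁻¹ * volume Q := by
    rw [← Measure.restrict_apply_self, discArea_restrict hQ]
    simp
  rw [hv, discArea_restrict hQ, lintegral_smul_measure, smul_eq_mul,
    ENNReal.mul_inv (.inl (ENNReal.inv_ne_zero.2 h1)) (.inl (ENNReal.inv_ne_top.2 h0)), inv_inv]
  rw [mul_mul_mul_comm, ENNReal.mul_inv_cancel h0 h1, one_mul]

/-- Polar coordinates with the angle measured from a point of the unit circle. -/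
noncomputable def polarPoint (ξ : Circle) (p : ℝ × ℝ) : ℂ :=
  (p.1 : ℂ) * (ξ * Circle.exp p.2 : Circle)

lemma norm_polarPoint (ξ : Circle) {p : ℝ × ℝ} (hp : 0 ≤ p.1) : ‖polarPoint ξ p‖ = p.1 :=
  norm_ofReal_mul_circle hp _

lemma measurable_polarPoint (ξ : Circle) : Measurable (polarPoint ξ) := by
  unfold polarPoint
  exact Continuous.measurable (by fun_prop)

/-- Rotation invariance of area moves the branch cut of polar coordinates opposite to the centre of
the arc. -/
lemma lintegral_polarPoint (ξ : Circle) (g : ℂ → ℝ≥0∞) :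
    ∫⁻ z, g z = ∫⁻ p in Set.Ioi (0 : ℝ) ×ˢ Set.Ioo (-Real.pi) Real.pi,
      ENNReal.ofReal p.1 * g (polarPoint ξ p) := by
  have h1 : ∫⁻ z, g z = ∫⁻ z, g (rotation ξ z) :=
    ((rotation ξ).measurePreserving.lintegral_comp_emb
      (rotation ξ).toHomeomorph.measurableEmbedding g).symm
  rw [h1, ← Complex.lintegral_comp_polarCoord_symm]
  refine setLIntegral_congr_fun (measurableSet_Ioi.prod measurableSet_Ioo) fun p _ ↦ ?_
  simp only [smul_eq_mul, polarPoint, rotation_apply, Complex.polarCoord_symm_apply]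
  congr 2
  push_cast
  rw [Complex.exp_mul_I]
  ring

lemma polarPoint_mem_carlesonBox {ξ : Circle} {l : ℝ} {p : ℝ × ℝ} (hp : 0 < p.1) (h1 : p.1 < 1)
    (hl : 1 - l ≤ p.1) {I : Set Circle} (h : ξ * Circle.exp p.2 ∈ I) :
    polarPoint ξ p ∈ carlesonBox I l := by
  have h2 := norm_polarPoint ξ hp.le
  refine ⟨by rwa [h2], by rw [h2]; linarith, _, h, ?_⟩
  rw [h2, polarPoint, mul_div_cancel_left₀ _ (by exact_mod_cast hp.ne')]

lemma mul_exp_mem_openArc {ξ : Circle} {l t : ℝ} (ht : |t| < Real.pi * l) :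
    ξ * Circle.exp t ∈ openArc ξ l := by
  have hp := Real.pi_pos
  refine ⟨t / (2 * Real.pi), abs_lt.1 ?_, ?_⟩
  · rw [abs_div, abs_of_pos Real.two_pi_pos, div_lt_iff₀ Real.two_pi_pos]
    linarith
  · simp only
    congr 2
    field_simp

/-- The factor `2⁻¹` bounds the polar Jacobian `r ≥ a ≥ 1/2` from below. -/
lemma lintegral_carlesonBox_ge (ξ : Circle) {l a b L : ℝ} (hl1 : l ≤ 1) (hal : 1 - l ≤ a)
    (ha : 1 / 2 ≤ a) (hb : b ≤ 1) (hL : L ≤ Real.pi * l) (g : ℂ → ℝ≥0∞) :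
    2⁻¹ * ∫⁻ p in Set.Ioo a b ×ˢ Set.Ioo (-L) L, g (polarPoint ξ p) ≤
      ∫⁻ z in carlesonBox (openArc ξ l) l, g z := by
  set S := Set.Ioo a b ×ˢ Set.Ioo (-L) L
  have hS : MeasurableSet S := measurableSet_Ioo.prod measurableSet_Ioo
  have hLpi : L ≤ Real.pi := hL.trans (by nlinarith [Real.pi_pos])
  refine le_trans ?_ (lintegral_indicator_le _ _)
  rw [lintegral_polarPoint ξ, ← lintegral_const_mul' _ _ (by simp)]
  refine le_trans ?_ (lintegral_mono_set (s := S) ?_)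
  · refine setLIntegral_mono' hS fun p hp ↦ ?_
    obtain ⟨⟨h1, h2⟩, h3⟩ := hp
    rw [Set.indicator_of_mem (polarPoint_mem_carlesonBox (by linarith) (by linarith) (by linarith)
      (mul_exp_mem_openArc ((abs_lt.2 h3).trans_le hL)))]
    gcongr
    rw [← ENNReal.ofReal_ofNat, ← ENNReal.ofReal_inv_of_pos two_pos]
    exact ENNReal.ofReal_le_ofReal (by linarith)
  · rintro p ⟨⟨h1, h2⟩, h3, h4⟩
    exact ⟨Set.mem_Ioi.2 (by linarith), by linarith, by linarith⟩

lemma measurableSet_carlesonBox_closedArc (ξ : Circle) (l : ℝ) :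
    MeasurableSet (carlesonBox (closedArc ξ l) l) := by
  have h : carlesonBox (closedArc ξ l) l = {z : ℂ | ‖z‖ < 1} ∩ {z : ℂ | 1 - ‖z‖ ≤ l} ∩
      (fun z : ℂ ↦ z / (‖z‖ : ℂ)) ⁻¹' ((fun ζ : Circle ↦ (ζ : ℂ)) '' closedArc ξ l) := by
    ext z
    simp [carlesonBox, and_assoc]
  rw [h]
  refine ((measurableSet_lt (by fun_prop) (by fun_prop)).inter
    (measurableSet_le (by fun_prop) (by fun_prop))).inter
    ((measurable_id.div (Complex.measurable_ofReal.comp measurable_norm))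
      ((isCompact_closedArc ξ l).image (by fun_prop)).isClosed.measurableSet)

lemma lintegral_carlesonBox_le (ξ : Circle) {l : ℝ} (hl1 : l ≤ 1) (g : ℂ → ℝ≥0∞) :
    ∫⁻ z in carlesonBox (closedArc ξ l) l, g z ≤
      ∫⁻ p in Set.Ico (1 - l) 1 ×ˢ Set.Icc (-(Real.pi * l)) (Real.pi * l), g (polarPoint ξ p) := by
  have hpi := Real.pi_pos
  have hQ := measurableSet_carlesonBox_closedArc ξ l
  set S := Set.Ico (1 - l) 1 ×ˢ Set.Icc (-(Real.pi * l)) (Real.pi * l)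
  have hS : MeasurableSet S := measurableSet_Ico.prod measurableSet_Icc
  rw [← lintegral_indicator hQ, lintegral_polarPoint ξ, ← lintegral_indicator hS]
  refine le_trans (setLIntegral_mono' (measurableSet_Ioi.prod measurableSet_Ioo)
    (g := S.indicator fun p ↦ g (polarPoint ξ p)) fun p hp ↦ ?_) (setLIntegral_le_lintegral _ _)
  by_cases hm : polarPoint ξ p ∈ carlesonBox (closedArc ξ l) l
  · obtain ⟨hp1, hp2, hp3⟩ := hp
    have hp1' : 0 < p.1 := hp1
    obtain ⟨h1, h2, ζ, hζ, h3⟩ := id hm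
    have hn := norm_polarPoint ξ hp1'.le
    rw [hn] at h1 h2
    rw [hn, polarPoint, mul_div_cancel_left₀ _ (by exact_mod_cast hp1'.ne'), Circle.coe_inj] at h3
    obtain ⟨t, ht, rfl⟩ := exists_eq_mul_exp_of_mem_closedArc hζ
    obtain ⟨m, hm2⟩ := Circle.exp_eq_exp.1 (mul_left_cancel h3)
    have ht2 := abs_le.1 ht
    -- Both angles have modulus at most `π`, and `p.2` strictly less, so they cannot differ by a
    -- nonzero multiple of `2π`, even when `l = 1`.
    have hm0 : m = 0 := by
      have h5 : (m : ℝ) < 1 := by nlinarith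
      have h6 : (-1 : ℝ) < m := by nlinarith
      have h7 : m < 1 := by exact_mod_cast h5
      have h8 : -1 < m := by exact_mod_cast h6
      omega
    have hpS : p ∈ S := by
      rw [hm0] at hm2
      simp only [Int.cast_zero, zero_mul, add_zero] at hm2
      rw [hm2] at ht2
      exact ⟨⟨by linarith, h1⟩, ht2⟩
    rw [Set.indicator_of_mem hm, Set.indicator_of_mem hpS]
    calc _ ≤ 1 * g (polarPoint ξ p) := by
          gcongr
          exact ENNReal.ofReal_le_one.2 h1.le
      _ = _ := one_mul _
  · rw [Set.indicator_of_notMem hm, mul_zero]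
    exact zero_le

lemma volume_carlesonBox_ge (ξ : Circle) {l : ℝ} (hl0 : 0 < l) (hl1 : l ≤ 1) :
    ENNReal.ofReal (Real.pi * l ^ 2 / 2) ≤ volume (carlesonBox (openArc ξ l) l) := by
  have h := lintegral_carlesonBox_ge ξ (a := 1 - l / 2) hl1 (by linarith) (by linarith) le_rfl
    le_rfl fun _ ↦ 1
  simp only [setLIntegral_one] at h
  refine le_trans (le_of_eq ?_) h
  rw [Measure.volume_eq_prod, Measure.prod_prod, Real.volume_Ioo, Real.volume_Ioo,
    ← ENNReal.ofReal_mul (by linarith), ← ENNReal.ofReal_ofNat,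
    ← ENNReal.ofReal_inv_of_pos two_pos, ← ENNReal.ofReal_mul (by norm_num)]
  congr 1
  ring

lemma volume_carlesonBox_le (ξ : Circle) {l : ℝ} (hl0 : 0 < l) (hl1 : l ≤ 1) :
    volume (carlesonBox (closedArc ξ l) l) ≤ ENNReal.ofReal (2 * Real.pi * l ^ 2) := by
  have h := lintegral_carlesonBox_le ξ hl1 fun _ ↦ 1
  simp only [setLIntegral_one] at h
  refine h.trans (le_of_eq ?_)
  rw [Measure.volume_eq_prod, Measure.prod_prod, Real.volume_Ico, Real.volume_Icc,
    ← ENNReal.ofReal_mul (by linarith)]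
  congr 1
  ring

/-! ### Radial growth of the Poisson integral, and (a) ⇒ (c) -/

lemma lintegral_one_sub_rpow {l D : ℝ} (hl0 : 0 < l) (hD1 : D < 1) {A : ℝ}
    (hA : 0 ≤ A) :
    ∫⁻ r in Set.Ico (1 - l) 1, ENNReal.ofReal (A * (2 * l / (1 - r)) ^ D) ≤
      ENNReal.ofReal (2 * A * l / (1 - D)) := by
  have h1 : ∀ r ∈ Set.Ioo (1 - l) 1, A * (2 * l / (1 - r)) ^ D =
      A * (2 * l) ^ D * (1 - r) ^ (-D) := fun r hr ↦ by
    rw [Real.div_rpow (by linarith) (by linarith [hr.2]), Real.rpow_neg (by linarith [hr.2])]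
    ring
  have hint : IntervalIntegrable (fun r : ℝ ↦ A * (2 * l) ^ D * (1 - r) ^ (-D)) volume
      (1 - l) 1 := by
    have h := ((intervalIntegral.intervalIntegrable_rpow' (a := l) (b := 0)
      (by linarith : -1 < -D)).comp_sub_left 1).const_mul (A * (2 * l) ^ D)
    simpa using h
  have hle : 1 - l ≤ 1 := by linarith
  rw [setLIntegral_congr Ioo_ae_eq_Ico.symm, setLIntegral_congr_fun measurableSet_Ioo
    (fun r hr ↦ by rw [h1 r hr]), setLIntegral_congr Ioo_ae_eq_Ioc,
    ← ofReal_integral_eq_lintegral_ofReal ((intervalIntegrable_iff_integrableOn_Ioc_of_le hle).1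
      hint)]
  · refine ENNReal.ofReal_le_ofReal ?_
    rw [← intervalIntegral.integral_of_le hle, intervalIntegral.integral_const_mul,
      intervalIntegral.integral_comp_sub_left (fun x ↦ x ^ (-D)), integral_rpow (.inl (by linarith)),
      sub_self, sub_sub_cancel, Real.zero_rpow (by linarith), sub_zero,
      Real.mul_rpow zero_le_two hl0.le]
    have h2 : l ^ D * l ^ (-D + 1) = l := by
      rw [← Real.rpow_add hl0]; simp
    have h3 : (2 : ℝ) ^ D ≤ 2 := by
      simpa using Real.rpow_le_rpow_of_exponent_le one_le_two hD1.le
    have h4 : 0 < 1 - D := by linarith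
    calc A * (2 ^ D * l ^ D) * (l ^ (-D + 1) / (-D + 1))
        = 2 ^ D * A * (l ^ D * l ^ (-D + 1)) / (1 - D) := by ring
      _ = 2 ^ D * A * l / (1 - D) := by rw [h2]
      _ ≤ _ := by gcongr
  · filter_upwards [ae_restrict_mem measurableSet_Ioc] with r hr
    have : 0 ≤ 1 - r := by linarith [hr.2]
    simp only [Pi.zero_apply]
    positivity

/-- The condition `D < 1` makes `(1 - r)^(-D)` integrable up to the circle; the integral is of order
`l²`, as is the area of the box, so the bound does not depend on `l`. -/
lemma average_carlesonBox_le {I : Set Circle} {ξ : Circle} {l : ℝ} (hI : IsArc I ξ l) {D A : ℝ}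
    (hD1 : D < 1) (hA : 0 ≤ A) {g : ℂ → ℝ≥0∞}
    (hg : ∀ p ∈ Set.Ico (1 - l) 1 ×ˢ Set.Icc (-(Real.pi * l)) (Real.pi * l),
      g (polarPoint ξ p) ≤ ENNReal.ofReal (A * (2 * l / (1 - p.1)) ^ D)) :
    (discArea (carlesonBox I l))⁻¹ * ∫⁻ z in carlesonBox I l, g z ∂discArea ≤
      ENNReal.ofReal (8 * A / (1 - D)) := by
  obtain ⟨hl0, hl1, hI1, hI2⟩ := hI
  have hpi := Real.pi_pos
  rw [discArea_average (carlesonBox_subset_ball I l)]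
  have hV := (volume_carlesonBox_ge ξ hl0 hl1).trans (measure_mono (carlesonBox_mono hI1 l))
  have hint : ∫⁻ z in carlesonBox I l, g z ≤
      ENNReal.ofReal (2 * A * l / (1 - D)) * ENNReal.ofReal (2 * Real.pi * l) := by
    calc _ ≤ ∫⁻ z in carlesonBox (closedArc ξ l) l, g z :=
          lintegral_mono_set (carlesonBox_mono hI2 l)
      _ ≤ _ := lintegral_carlesonBox_le ξ hl1 g
      _ ≤ ∫⁻ p in Set.Ico (1 - l) 1 ×ˢ Set.Icc (-(Real.pi * l)) (Real.pi * l),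
            ENNReal.ofReal (A * (2 * l / (1 - p.1)) ^ D) :=
          setLIntegral_mono' (measurableSet_Ico.prod measurableSet_Icc) hg
      _ = (∫⁻ r in Set.Ico (1 - l) 1, ENNReal.ofReal (A * (2 * l / (1 - r)) ^ D)) *
            ENNReal.ofReal (2 * Real.pi * l) := by
          rw [Measure.volume_eq_prod, setLIntegral_prod _ (by fun_prop)]
          simp only [setLIntegral_const, Real.volume_Icc]
          rw [lintegral_mul_const' _ _ ENNReal.ofReal_ne_top]
          congr 2
          ring
      _ ≤ _ := by gcongr; exact lintegral_one_sub_rpow hl0 hD1 hA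
  have hD : 0 < 1 - D := by linarith
  calc _ ≤ (ENNReal.ofReal (Real.pi * l ^ 2 / 2))⁻¹ *
        (ENNReal.ofReal (2 * A * l / (1 - D)) * ENNReal.ofReal (2 * Real.pi * l)) := by gcongr
    _ = _ := by
        rw [← ENNReal.ofReal_mul (by positivity), ← ENNReal.ofReal_inv_of_pos (by positivity),
          ← ENNReal.ofReal_mul (by positivity)]
        congr 1
        field_simp
        ring

/-- Along a radius, the logarithm of the Poisson integral varies at most as fast as
`D` times hyperbolic length. -/
lemma abs_log_poissonIntegral_sub_le {σ : Measure Circle} [IsFiniteMeasure σ] {D : ℝ}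
    (hu : ∀ z : ℂ, ‖z‖ < 1 → 0 < poissonIntegral σ z)
    (hD : ∀ z : ℂ, ‖z‖ < 1 → (1 - ‖z‖ ^ 2) *
      ‖∫ ξ : Circle, 2 * (ξ : ℂ) / ((ξ : ℂ) - z) ^ 2 ∂σ‖ / (2 * poissonIntegral σ z) ≤ D)
    (ζ : Circle) {s r : ℝ} (hs : 0 ≤ s) (hsr : s ≤ r) (hr : r < 1) :
    |Real.log (poissonIntegral σ (r * ζ)) - Real.log (poissonIntegral σ (s * ζ))| ≤
      D * ((Real.log (1 + r) - Real.log (1 - r)) - (Real.log (1 + s) - Real.log (1 - s))) := by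
  have hn : ∀ t ∈ Set.Ico (0 : ℝ) 1, ‖(t : ℂ) * ζ‖ = t := fun t ht ↦ norm_ofReal_mul_circle ht.1 ζ
  have hu' : ∀ t ∈ Set.Ico (0 : ℝ) 1, 0 < poissonIntegral σ (t * ζ) := fun t ht ↦
    hu _ (by rw [hn t ht]; exact ht.2)
  -- Since `u = Re H`, the radial derivative of `u` is at most `|H'|` in modulus, so that of `log u`
  -- is at most `2D/(1 - t²)`, which is the derivative of `D log((1 + t)/(1 - t))`.
  have hder : ∀ t ∈ Set.Ico (0 : ℝ) 1, ∃ d : ℝ,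
      HasDerivWithinAt (fun t : ℝ ↦ Real.log (poissonIntegral σ (t * ζ))) d (Set.Ico 0 1) t ∧
      |d| ≤ D * (2 / (1 - t ^ 2)) := by
    intro t ht
    have hlt : ‖(t : ℂ) * ζ‖ < 1 := by rw [hn t ht]; exact ht.2
    set H' := ∫ ξ : Circle, 2 * (ξ : ℂ) / ((ξ : ℂ) - t * ζ) ^ 2 ∂σ with hH'
    have h1 : HasDerivAt (fun t : ℝ ↦ (t : ℂ) * ζ) (ζ : ℂ) t := by
      simpa using (Complex.ofRealCLM.hasDerivAt (x := t)).mul_const (ζ : ℂ)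
    have h2 : HasDerivAt (fun t : ℝ ↦ herglotzIntegral σ (t * ζ)) (H' * ζ) t :=
      HasDerivAt.comp (h₂ := herglotzIntegral σ) (h := fun t : ℝ ↦ (t : ℂ) * ζ) t
        (hasDerivAt_herglotzIntegral σ hlt) h1
    have h3 : HasDerivAt (fun t : ℝ ↦ (herglotzIntegral σ (t * ζ)).re) (H' * ζ).re t :=
      Complex.reCLM.hasFDerivAt.comp_hasDerivAt t h2
    have h4 : HasDerivWithinAt (fun t : ℝ ↦ poissonIntegral σ (t * ζ)) (H' * ζ).re
        (Set.Ico 0 1) t :=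
      h3.hasDerivWithinAt.congr_of_mem (fun x hx ↦ (re_herglotzIntegral σ
        (by rw [hn x hx]; exact hx.2)).symm) ht
    refine ⟨_, h4.log (hu' t ht).ne', ?_⟩
    have h5 := hD _ hlt
    have hp := hu' t ht
    rw [hn t ht, div_le_iff₀ (by positivity)] at h5
    have h6 : |(H' * ζ).re| ≤ ‖H'‖ := by
      simpa only [norm_mul, Circle.norm_coe, mul_one] using Complex.abs_re_le_norm (H' * ζ)
    have h7 : 0 < 1 - t ^ 2 := by nlinarith [ht.1, ht.2]
    rw [abs_div, abs_of_pos hp, div_le_iff₀ hp]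
    refine h6.trans ?_
    rw [← mul_div_assoc, div_mul_eq_mul_div, le_div_iff₀ h7]
    linarith
  have hL : ∀ t ∈ Set.Ico (0 : ℝ) 1, HasDerivWithinAt
      (fun t : ℝ ↦ D * (Real.log (1 + t) - Real.log (1 - t))) (D * (2 / (1 - t ^ 2)))
      (Set.Ico 0 1) t := by
    intro t ht
    have h1 : (1 + t) ≠ 0 := by linarith [ht.1]
    have h2 : (1 - t) ≠ 0 := by linarith [ht.2]
    have h3 : 1 - t ^ 2 ≠ 0 := by
      rw [show 1 - t ^ 2 = (1 + t) * (1 - t) by ring]; exact mul_ne_zero h1 h2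
    refine HasDerivAt.hasDerivWithinAt (HasDerivAt.congr_deriv (((((hasDerivAt_id t).const_add
      1).log h1).sub (((hasDerivAt_id t).const_sub 1).log h2)).const_mul D) ?_)
    simp only [id_eq]
    field_simp
    ring
  choose! d hd hdb using hder
  have hmono : ∀ g : ℝ → ℝ, ∀ g' : ℝ → ℝ,
      (∀ t ∈ Set.Ico (0 : ℝ) 1, HasDerivWithinAt g (g' t) (Set.Ico 0 1) t) →
      (∀ t ∈ Set.Ico (0 : ℝ) 1, 0 ≤ g' t) → g s ≤ g r := by
    intro g g' hg hg'
    have hm : MonotoneOn g (Set.Ico (0 : ℝ) 1) :=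
      monotoneOn_of_hasDerivWithinAt_nonneg (convex_Ico 0 1)
        (fun t ht ↦ (hg t ht).continuousWithinAt)
        (fun t ht ↦ (hg t (interior_subset ht)).mono interior_subset)
        (fun t ht ↦ hg' t (interior_subset ht))
    exact hm ⟨hs, by linarith⟩ ⟨by linarith, hr⟩ hsr
  -- Both `D log((1 + t)/(1 - t)) ∓ log u` are nondecreasing, which gives the two sides of the
  -- absolute value.
  have h1 := hmono _ _ (fun t ht ↦ (hL t ht).sub (hd t ht))
    fun t ht ↦ by linarith [(abs_le.1 (hdb t ht)).2]
  have h2 := hmono _ _ (fun t ht ↦ (hL t ht).add (hd t ht))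
    fun t ht ↦ by linarith [(abs_le.1 (hdb t ht)).1]
  simp only [Pi.sub_apply, Pi.add_apply] at h1 h2
  rw [abs_le]
  constructor <;> linarith

lemma bekolleBonamiB2_lt_top_of_isContractive {f : ℂ → ℂ}
    (hf : DifferentiableOn ℂ f (ball (0 : ℂ) 1))
    (hmaps : Set.MapsTo f (ball (0 : ℂ) 1) (ball (0 : ℂ) 1))
    {σ : Measure Circle} (hσ : IsAleksandrovClarkMeasure f σ) (h : IsContractive f) :
    bekolleBonamiB2 (poissonIntegral σ) < ⊤ := by
  have := hσ.1
  have hpi := Real.pi_pos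
  have hpi4 := Real.pi_lt_four
  obtain ⟨D, hD1, hD⟩ := h
  have hu : ∀ z : ℂ, ‖z‖ < 1 → 0 < poissonIntegral σ z := fun z hz ↦
    (hσ.pos_and_hyperbolicDeriv_eq hf hmaps hz).1
  have hD' : ∀ z : ℂ, ‖z‖ < 1 → (1 - ‖z‖ ^ 2) *
      ‖∫ ξ : Circle, 2 * (ξ : ℂ) / ((ξ : ℂ) - z) ^ 2 ∂σ‖ / (2 * poissonIntegral σ z) ≤ D :=
    fun z hz ↦ by
      rw [← (hσ.pos_and_hyperbolicDeriv_eq hf hmaps hz).2]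
      exact hD z (by simpa using hz)
  have hD0 : 0 ≤ D := by
    refine le_trans ?_ (hD' 0 (by simp))
    have := hu 0 (by simp)
    simp only [norm_zero]
    positivity
  have hDp : 0 < 1 - D := by linarith
  refine lt_of_le_of_lt (b := ENNReal.ofReal ((200 / (1 - D)) ^ 2)) ?_ ENNReal.ofReal_lt_top
  refine iSup_le fun I ↦ iSup_le fun ξ ↦ iSup_le fun l ↦ iSup_le fun hI ↦ ?_
  obtain ⟨hl0, hl1, -⟩ := id hI
  set U := poissonIntegral σ (((1 - l : ℝ) : ℂ) * ξ) with hU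
  have hnorm : ∀ ζ : Circle, ‖((1 - l : ℝ) : ℂ) * ζ‖ = 1 - l := fun ζ ↦
    norm_ofReal_mul_circle (by linarith) ζ
  have hU0 : 0 < U := hu _ (by rw [hnorm]; linarith)
  -- Points on the inner edge of the box have equal height `l` and are within `4l` of `z_I`; hence
  -- `25 = (1 + 4)²`.
  have hlat : ∀ t : ℝ, |t| ≤ Real.pi * l →
      U ≤ 25 * poissonIntegral σ (((1 - l : ℝ) : ℂ) * (ξ * Circle.exp t : Circle)) ∧
      poissonIntegral σ (((1 - l : ℝ) : ℂ) * (ξ * Circle.exp t : Circle)) ≤ 25 * U := by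
    intro t ht
    have hdist : ‖((1 - l : ℝ) : ℂ) * ((ξ * Circle.exp t : Circle) : ℂ) -
        ((1 - l : ℝ) : ℂ) * ξ‖ ≤ 4 * l := by
      rw [← mul_sub, norm_mul, Complex.norm_real, Real.norm_of_nonneg (by linarith)]
      have h1 := norm_circle_mul_exp_sub_le ξ t
      calc _ ≤ 1 * |t| := by gcongr; linarith
        _ ≤ 4 * l := by nlinarith
    have h1 := poissonIntegral_le_mul σ (M := 1) (K := 4)
      (z := ((1 - l : ℝ) : ℂ) * ((ξ * Circle.exp t : Circle) : ℂ)) (w := ((1 - l : ℝ) : ℂ) * ξ)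
      (by rw [hnorm]; linarith) (by rw [hnorm]; linarith) (by rw [hnorm, hnorm, one_mul])
      (by rw [hnorm]; linarith)
    have h2 := poissonIntegral_le_mul σ (M := 1) (K := 4)
      (w := ((1 - l : ℝ) : ℂ) * ((ξ * Circle.exp t : Circle) : ℂ)) (z := ((1 - l : ℝ) : ℂ) * ξ)
      (by rw [hnorm]; linarith) (by rw [hnorm]; linarith) (by rw [hnorm, hnorm, one_mul])
      (by rw [norm_sub_rev, hnorm]; linarith)
    constructor <;> linarith
  have hrad : ∀ p ∈ Set.Ico (1 - l) 1 ×ˢ Set.Icc (-(Real.pi * l)) (Real.pi * l),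
      poissonIntegral σ (polarPoint ξ p) ≤ 25 * U * (2 * l / (1 - p.1)) ^ D ∧
      1 / poissonIntegral σ (polarPoint ξ p) ≤ 25 / U * (2 * l / (1 - p.1)) ^ D := by
    rintro ⟨r, t⟩ ⟨⟨hr1, hr2⟩, ht⟩
    simp only at hr1 hr2 ht ⊢
    obtain ⟨hlat1, hlat2⟩ := hlat t (abs_le.2 ht)
    have h1 := abs_log_poissonIntegral_sub_le hu hD' (ξ * Circle.exp t) (s := 1 - l) (r := r)
      (by linarith) hr1 hr2
    have hr3 : 0 < 1 - r := by linarith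
    have hX : 0 < 2 * l / (1 - r) := by positivity
    have h2 : (Real.log (1 + r) - Real.log (1 - r)) -
        (Real.log (1 + (1 - l)) - Real.log (1 - (1 - l))) ≤ Real.log (2 * l / (1 - r)) := by
      rw [Real.log_div (by positivity) hr3.ne', Real.log_mul two_ne_zero hl0.ne', sub_sub_cancel]
      have h3 : Real.log (1 + r) ≤ Real.log 2 := Real.log_le_log (by linarith) (by linarith)
      have h4 : 0 ≤ Real.log (1 + (1 - l)) := Real.log_nonneg (by linarith)
      linarith
    have h3 := h1.trans (mul_le_mul_of_nonneg_left h2 hD0)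
    have hv : 0 < poissonIntegral σ (polarPoint ξ (r, t)) :=
      hu _ (by rw [norm_polarPoint ξ (by simp only; linarith)]; exact hr2)
    have hw := hu (((1 - l : ℝ) : ℂ) * (ξ * Circle.exp t : Circle)) (by rw [hnorm]; linarith)
    change |Real.log (poissonIntegral σ (polarPoint ξ (r, t))) - _| ≤ _ at h3
    set v := poissonIntegral σ (polarPoint ξ (r, t))
    set w := poissonIntegral σ (((1 - l : ℝ) : ℂ) * (ξ * Circle.exp t : Circle))
    set X := (2 * l / (1 - r)) ^ D with hXdef
    have hX0 : 0 < X := Real.rpow_pos_of_pos hX D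
    have hlogX : Real.log X = D * Real.log (2 * l / (1 - r)) := Real.log_rpow hX D
    rw [← hlogX, abs_le] at h3
    have hvw : v ≤ w * X := by
      rw [← Real.log_le_log_iff hv (by positivity), Real.log_mul hw.ne' hX0.ne']
      linarith
    have hwv : w ≤ v * X := by
      rw [← Real.log_le_log_iff hw (by positivity), Real.log_mul hv.ne' hX0.ne']
      linarith
    constructor
    · calc v ≤ w * X := hvw
        _ ≤ 25 * U * X := by gcongr
    · rw [div_mul_eq_mul_div, div_le_div_iff₀ hv hU0]
      nlinarith
  have hA1 := average_carlesonBox_le hI hD1 (by positivity : 0 ≤ 25 * U)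
    (g := fun z ↦ ENNReal.ofReal (poissonIntegral σ z))
    fun p hp ↦ ENNReal.ofReal_le_ofReal (hrad p hp).1
  have hA2 := average_carlesonBox_le hI hD1 (by positivity : 0 ≤ 25 / U)
    (g := fun z ↦ ENNReal.ofReal (1 / poissonIntegral σ z))
    fun p hp ↦ ENNReal.ofReal_le_ofReal (hrad p hp).2
  refine (mul_le_mul' hA1 hA2).trans (le_of_eq ?_)
  rw [← ENNReal.ofReal_mul (by positivity)]
  congr 1
  field_simp
  ring

/-! ### Angular means of the Poisson integral, and (c) ⇒ (b) -/

lemma measurable_uncurry_circlePoissonKernel :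
    Measurable (Function.uncurry circlePoissonKernel) := by
  unfold circlePoissonKernel Function.uncurry
  have h : Measurable fun p : ℂ × Circle ↦ ‖(p.2 : ℂ) - p.1‖ ^ 2 :=
    Continuous.measurable (by fun_prop)
  exact Measurable.div (by fun_prop) h

lemma measurable_poissonIntegral (σ : Measure Circle) [IsFiniteMeasure σ] :
    Measurable (poissonIntegral σ) :=
  (measurable_uncurry_circlePoissonKernel.stronglyMeasurable.integral_prod_right).measurable

lemma circle_mul_conj (ξ : Circle) : (ξ : ℂ) * starRingEnd ℂ (ξ : ℂ) = 1 := by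
  rw [Complex.mul_conj, Complex.normSq_eq_norm_sq, Circle.norm_coe]; simp

/-- Conjugation and rotation exchange the roles of the two points: the kernel at `η`, as a function
of the angle `θ`, becomes the standard kernel with a fixed interior point. Its mean over the circle
is therefore `1`. -/
lemma norm_circle_sub_polarPoint (ξ η : Circle) (r θ : ℝ) :
    ‖(η : ℂ) - polarPoint ξ (r, θ)‖ = ‖circleMap 0 1 θ - r * (η / ξ : Circle)‖ := by
  have hη := circle_mul_conj η
  have he := circle_mul_conj (Circle.exp θ)
  have h1 : circleMap 0 1 θ - r * (η / ξ : Circle) =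
      (Circle.exp θ : ℂ) * η * starRingEnd ℂ ((η : ℂ) - polarPoint ξ (r, θ)) := by
    have h2 : circleMap 0 1 θ = Circle.exp θ := by simp [circleMap]
    have h3 : ((η / ξ : Circle) : ℂ) = η * starRingEnd ℂ (ξ : ℂ) := by
      rw [div_eq_mul_inv, Circle.coe_mul, Circle.coe_inv_eq_conj]
    rw [h2, h3, polarPoint, Circle.coe_mul]
    simp only [map_sub, map_mul, Complex.conj_ofReal]
    linear_combination (-(Circle.exp θ : ℂ)) * hη + r * η * starRingEnd ℂ (ξ : ℂ) * he
  rw [h1, norm_mul, norm_mul, Circle.norm_coe, Circle.norm_coe, RCLike.norm_conj, one_mul, one_mul]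

lemma integral_circlePoissonKernel_polarPoint (ξ η : Circle) {r : ℝ} (hr0 : 0 ≤ r) (hr : r < 1) :
    ∫ θ in -Real.pi..Real.pi, circlePoissonKernel (polarPoint ξ (r, θ)) η = 2 * Real.pi := by
  set w : ℂ := r * (η / ξ : Circle) with hwdef
  have hw : ‖w‖ = r := norm_ofReal_mul_circle hr0 _
  have h1 := (diffContOnCl_const (𝕜 := ℂ) (c := (1 : ℂ)) (s := ball (0 : ℂ) 1)
    ).circleAverage_poissonKernel_smul (w := w) (by simpa [hw] using hr)
  have hk : ∀ θ, (poissonKernel 0 w • fun _ : ℂ ↦ (1 : ℂ)) (circleMap 0 1 θ) =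
      ((circlePoissonKernel (polarPoint ξ (r, θ)) η : ℝ) : ℂ) := by
    intro θ
    rw [circlePoissonKernel, norm_circle_sub_polarPoint, norm_polarPoint ξ (by exact hr0), ← hwdef]
    simp [poissonKernel, hw]
  have hper : Function.Periodic (fun θ ↦ circlePoissonKernel (polarPoint ξ (r, θ)) η)
      (2 * Real.pi) := by
    intro θ
    simp only [polarPoint, Circle.periodic_exp θ]
  rw [Real.circleAverage_def] at h1
  simp_rw [hk] at h1
  rw [intervalIntegral.integral_ofReal, Complex.real_smul, ← Complex.ofReal_mul,
    Complex.ofReal_eq_one, inv_mul_eq_one₀ Real.two_pi_pos.ne'] at h1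
  have h2 := hper.intervalIntegral_add_eq (-Real.pi) 0
  rw [zero_add, ← h1, show -Real.pi + 2 * Real.pi = Real.pi by ring] at h2
  exact h2

/-- The angular gap of more than `πl/4` forces a chord of at least `l/2`. That chord is at most `|η
- z| + (1 - r)`, and `1 - r ≤ |η - z|`. -/
lemma norm_circle_sub_polarPoint_ge {ξ η : Circle} {l r θ : ℝ} (hη : η ∉ closedArc ξ (l / 2))
    (hθ : |θ| ≤ Real.pi * l / 4) (hr0 : 0 ≤ r) (hr : r < 1) :
    l / 4 ≤ ‖(η : ℂ) - polarPoint ξ (r, θ)‖ := by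
  have hpi := Real.pi_pos
  set ζ : Circle := ξ * Circle.exp θ with hζ
  have hchord : l / 2 ≤ ‖(η : ℂ) - ζ‖ := by
    by_contra! hlt
    have h1 := Complex.angle_le_mul_norm_sub (Circle.norm_coe η) (Circle.norm_coe ζ)
    rw [Complex.angle_eq_abs_arg (Circle.coe_ne_zero η) (Circle.coe_ne_zero ζ), ← Circle.coe_div]
      at h1
    refine hη ?_
    have h2 : η = ξ * Circle.exp (θ + ((η / ζ : Circle) : ℂ).arg) := by
      rw [Circle.exp_add, Circle.exp_arg, ← mul_assoc, ← hζ, mul_div_cancel]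
    rw [h2]
    refine mul_exp_mem_closedArc ((abs_add_le _ _).trans ?_)
    nlinarith
  have h3 : ‖(η : ℂ) - ζ‖ ≤ ‖(η : ℂ) - polarPoint ξ (r, θ)‖ + (1 - r) := by
    have h4 : polarPoint ξ (r, θ) - ζ = -(((1 - r : ℝ) : ℂ) * ζ) := by
      simp only [polarPoint, ← hζ]; push_cast; ring
    have h5 := norm_sub_le_norm_sub_add_norm_sub (η : ℂ) (polarPoint ξ (r, θ)) ζ
    rwa [h4, norm_neg, norm_ofReal_mul_circle (by linarith)] at h5
  have h6 := one_sub_norm_le_norm_circle_sub (polarPoint ξ (r, θ)) η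
  rw [norm_polarPoint ξ (by exact hr0)] at h6
  simp only at h6
  linarith

/-- Mass far from the point influences it only in proportion to its height, whence the gain `(1 -
r)/l`. The constant is `162 = 2 * 9²`, where `9 = 1 + 8` because `2l ≤ 8|η - z|`. -/
lemma circlePoissonKernel_polarPoint_le {ξ η : Circle} {l r θ : ℝ} (hl0 : 0 < l) (hl1 : l ≤ 1)
    (hη : η ∉ closedArc ξ (l / 2)) (hθ : |θ| ≤ Real.pi * l / 4) (hrl : 1 - l ≤ r) (hr : r < 1) :
    circlePoissonKernel (polarPoint ξ (r, θ)) η ≤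
      162 * ((1 - r) / l) * circlePoissonKernel (((1 - l : ℝ) : ℂ) * ξ) η := by
  have hr0 : 0 ≤ r := by linarith
  have hpi4 := Real.pi_lt_four
  have h1 := norm_circle_sub_polarPoint_ge hη hθ hr0 hr
  have hn : ‖polarPoint ξ (r, θ)‖ = r := norm_polarPoint ξ hr0
  have hn' : ‖((1 - l : ℝ) : ℂ) * ξ‖ = 1 - l := norm_ofReal_mul_circle (by linarith) ξ
  have h2 : ‖polarPoint ξ (r, θ) - ((1 - l : ℝ) : ℂ) * ξ‖ ≤ 2 * l := by
    have h3 : polarPoint ξ (r, θ) - ((1 - l : ℝ) : ℂ) * ξ =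
        (r : ℂ) * (((ξ * Circle.exp θ : Circle) : ℂ) - ξ) + ((r - (1 - l) : ℝ) : ℂ) * ξ := by
      simp only [polarPoint]; push_cast; ring
    have h4 := norm_circle_mul_exp_sub_le ξ θ
    calc _ ≤ ‖(r : ℂ) * (((ξ * Circle.exp θ : Circle) : ℂ) - ξ)‖ +
          ‖((r - (1 - l) : ℝ) : ℂ) * ξ‖ := by rw [h3]; exact norm_add_le _ _
      _ ≤ 1 * |θ| + (r - (1 - l)) := by
          rw [norm_ofReal_mul_circle (by linarith), norm_mul, Complex.norm_real,
            Real.norm_of_nonneg hr0]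
          gcongr
      _ ≤ 2 * l := by nlinarith
  refine (circlePoissonKernel_le_mul (M := 2 * ((1 - r) / l)) (K := 9) (by rw [hn]; exact hr)
    (w := ((1 - l : ℝ) : ℂ) * ξ) (by rw [hn']; linarith) η ?_ ?_).trans (le_of_eq (by ring))
  · rw [hn, hn']
    have h5 : 2 * ((1 - r) / l) * (1 - (1 - l) ^ 2) = 2 * (1 - r) * (2 - l) := by
      field_simp; ring
    rw [h5]
    nlinarith
  · have := norm_sub_le_norm_sub_add_norm_sub (η : ℂ) (polarPoint ξ (r, θ))
      (((1 - l : ℝ) : ℂ) * ξ)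
    linarith

lemma lintegral_circlePoissonKernel_polarPoint_le (ξ η : Circle) {r : ℝ} (hr0 : 0 ≤ r)
    (hr : r < 1) {E : Set ℝ} (hE : E ⊆ Set.Ioc (-Real.pi) Real.pi) :
    ∫⁻ θ in E, ENNReal.ofReal (circlePoissonKernel (polarPoint ξ (r, θ)) η) ≤
      ENNReal.ofReal (2 * Real.pi) := by
  have hn : ∀ θ, ‖polarPoint ξ (r, θ)‖ < 1 := fun θ ↦ by
    rw [norm_polarPoint ξ (by exact hr0)]; exact hr
  have hc : Continuous fun θ ↦ circlePoissonKernel (polarPoint ξ (r, θ)) η := by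
    unfold circlePoissonKernel
    refine Continuous.div ?_ ?_ fun θ ↦ (pow_pos (norm_circle_sub_pos (hn θ) η) 2).ne'
    all_goals unfold polarPoint; fun_prop
  calc _ ≤ ∫⁻ θ in Set.Ioc (-Real.pi) Real.pi,
        ENNReal.ofReal (circlePoissonKernel (polarPoint ξ (r, θ)) η) := lintegral_mono_set hE
    _ = ENNReal.ofReal (∫ θ in -Real.pi..Real.pi,
          circlePoissonKernel (polarPoint ξ (r, θ)) η) := by
        rw [intervalIntegral.integral_of_le (by linarith [Real.pi_pos]),
          ofReal_integral_eq_lintegral_ofReal]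
        · exact (hc.integrableOn_Icc).mono_set Set.Ioc_subset_Icc_self
        · exact Filter.Eventually.of_forall fun θ ↦ (circlePoissonKernel_pos (hn θ) η).le
    _ = _ := by rw [integral_circlePoissonKernel_polarPoint ξ η hr0 hr]

lemma measurable_circlePoissonKernel_polarPoint (ξ : Circle) (r : ℝ) :
    Measurable (Function.uncurry fun (θ : ℝ) (η : Circle) ↦
      ENNReal.ofReal (circlePoissonKernel (polarPoint ξ (r, θ)) η)) := by
  have h1 : Measurable fun q : ℝ × Circle ↦ polarPoint ξ (r, q.1) :=
    (measurable_polarPoint ξ).comp (measurable_const.prodMk measurable_fst)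
  have h2 : Measurable fun q : ℝ × Circle ↦ (polarPoint ξ (r, q.1), q.2) :=
    h1.prodMk measurable_snd
  exact (measurable_uncurry_circlePoissonKernel.comp h2).ennreal_ofReal

/-- After Tonelli, mass on the half arc costs at most the full circle integral `2π` of the kernel;
mass off it costs `162(1 - r)/l` times the angular length `πl/2`. -/
lemma lintegral_poissonIntegral_polarPoint_le (σ : Measure Circle) [IsFiniteMeasure σ]
    (ξ : Circle) {l r : ℝ} (hl0 : 0 < l) (hl1 : l ≤ 1) (hrl : 1 - l ≤ r) (hr : r < 1) :
    ∫⁻ θ in Set.Ioo (-(Real.pi * l / 4)) (Real.pi * l / 4),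
        ENNReal.ofReal (poissonIntegral σ (polarPoint ξ (r, θ))) ≤
      ENNReal.ofReal (2 * Real.pi * σ.real (closedArc ξ (l / 2)) +
        81 * Real.pi * (1 - r) * poissonIntegral σ (((1 - l : ℝ) : ℂ) * ξ)) := by
  have hr0 : 0 ≤ r := by linarith
  have hpi := Real.pi_pos
  set E := Set.Ioo (-(Real.pi * l / 4)) (Real.pi * l / 4)
  set J := closedArc ξ (l / 2)
  have hn : ∀ θ, ‖polarPoint ξ (r, θ)‖ < 1 := fun θ ↦ by
    rw [norm_polarPoint ξ (by exact hr0)]; exact hr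
  have hn' : ‖((1 - l : ℝ) : ℂ) * ξ‖ < 1 := by
    rw [norm_ofReal_mul_circle (by linarith) ξ]; linarith
  have hmeas := measurable_circlePoissonKernel_polarPoint ξ r
  have hfull : ∀ η, ∫⁻ θ in E, ENNReal.ofReal (circlePoissonKernel (polarPoint ξ (r, θ)) η) ≤
      ENNReal.ofReal (2 * Real.pi) := fun η ↦
    lintegral_circlePoissonKernel_polarPoint_le ξ η hr0 hr fun θ hθ ↦
      ⟨by nlinarith [hθ.1], by nlinarith [hθ.2]⟩
  have hoff : ∀ η ∈ Jᶜ, ∫⁻ θ in E, ENNReal.ofReal (circlePoissonKernel (polarPoint ξ (r, θ)) η) ≤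
      ENNReal.ofReal (81 * Real.pi * (1 - r)) *
        ENNReal.ofReal (circlePoissonKernel (((1 - l : ℝ) : ℂ) * ξ) η) := by
    intro η hη
    have hk := circlePoissonKernel_pos hn' η
    have h1r : 0 < 1 - r := by linarith
    calc _ ≤ ∫⁻ θ in E, ENNReal.ofReal (162 * ((1 - r) / l) *
          circlePoissonKernel (((1 - l : ℝ) : ℂ) * ξ) η) :=
          setLIntegral_mono' measurableSet_Ioo fun θ hθ ↦ ENNReal.ofReal_le_ofReal
            (circlePoissonKernel_polarPoint_le hl0 hl1 hη (abs_le.2 ⟨hθ.1.le, hθ.2.le⟩) hrl hr)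
      _ = _ := by
          rw [setLIntegral_const, Real.volume_Ioo, ← ENNReal.ofReal_mul (by positivity),
            ← ENNReal.ofReal_mul (by positivity)]
          congr 1
          field_simp
          ring
  calc _ = ∫⁻ θ in E, ∫⁻ η, ENNReal.ofReal (circlePoissonKernel (polarPoint ξ (r, θ)) η) ∂σ := by
        simp_rw [ofReal_poissonIntegral σ (hn _)]
    _ = ∫⁻ η, (∫⁻ θ in E, ENNReal.ofReal (circlePoissonKernel (polarPoint ξ (r, θ)) η))
          ∂σ :=
        lintegral_lintegral_swap hmeas.aemeasurable
    _ = (∫⁻ η in J, (∫⁻ θ in E, ENNReal.ofReal (circlePoissonKernel (polarPoint ξ (r, θ)) η))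
          ∂σ) +
        ∫⁻ η in Jᶜ, (∫⁻ θ in E, ENNReal.ofReal (circlePoissonKernel (polarPoint ξ (r, θ)) η))
          ∂σ :=
        (lintegral_add_compl _ (measurableSet_closedArc _ _)).symm
    _ ≤ (∫⁻ η in J, ENNReal.ofReal (2 * Real.pi) ∂σ) +
        ∫⁻ η in Jᶜ, ENNReal.ofReal (81 * Real.pi * (1 - r)) *
          ENNReal.ofReal (circlePoissonKernel (((1 - l : ℝ) : ℂ) * ξ) η) ∂σ :=
        add_le_add (lintegral_mono hfull)
          (setLIntegral_mono' (measurableSet_closedArc _ _).compl hoff)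
    _ ≤ ENNReal.ofReal (2 * Real.pi) * σ J + ENNReal.ofReal (81 * Real.pi * (1 - r)) *
        ENNReal.ofReal (poissonIntegral σ (((1 - l : ℝ) : ℂ) * ξ)) := by
        rw [setLIntegral_const, lintegral_const_mul' _ _ ENNReal.ofReal_ne_top,
          ofReal_poissonIntegral σ hn']
        gcongr
        exact Measure.restrict_le_self
    _ = _ := by
        have h1r : 0 < 1 - r := by linarith
        have hu : 0 ≤ poissonIntegral σ (((1 - l : ℝ) : ℂ) * ξ) :=
          integral_nonneg fun η ↦ (circlePoissonKernel_pos hn' η).le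
        rw [← ofReal_measureReal, ← ENNReal.ofReal_mul (by positivity),
          ← ENNReal.ofReal_mul (by positivity), ← ENNReal.ofReal_add (by positivity)
            (by positivity)]

/-- Jensen's inequality for the reciprocal. -/
lemma lintegral_ofReal_inv_ge {α : Type*} [MeasurableSpace α] {μ : Measure α} {v : α → ℝ}
    (hv : Measurable v) (hv0 : ∀ x, 0 < v x) {L m : ℝ} (hL : 0 ≤ L) (hm : 0 < m)
    (hμ : μ Set.univ = ENNReal.ofReal L)
    (h : ∫⁻ x, ENNReal.ofReal (v x) ∂μ ≤ ENNReal.ofReal (L * m)) :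
    ENNReal.ofReal (L / m) ≤ ∫⁻ x, ENNReal.ofReal (1 / v x) ∂μ := by
  -- Integrate the tangent line bound `1/v ≥ 2/m - v/m²`, with the negative term moved across since
  -- extended nonnegative reals do not subtract well.
  have h1 : ENNReal.ofReal (L / m) + ENNReal.ofReal (L / m) ≤
      (∫⁻ x, ENNReal.ofReal (1 / v x) ∂μ) + ENNReal.ofReal (L / m) := by
    calc _ = ∫⁻ x, ENNReal.ofReal (2 / m) ∂μ := by
          rw [lintegral_const, hμ, ← ENNReal.ofReal_mul (by positivity),
            ← ENNReal.ofReal_add (by positivity) (by positivity)]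
          congr 1
          ring
      _ ≤ ∫⁻ x, (ENNReal.ofReal (1 / v x) + ENNReal.ofReal (1 / m ^ 2) * ENNReal.ofReal (v x)) ∂μ :=
          lintegral_mono fun x ↦ by
            have hx := hv0 x
            rw [← ENNReal.ofReal_mul (by positivity), ← ENNReal.ofReal_add (by positivity)
              (by positivity)]
            refine ENNReal.ofReal_le_ofReal ?_
            have h2 : 1 / v x + 1 / m ^ 2 * v x - 2 / m = (v x - m) ^ 2 / (v x * m ^ 2) := by
              field_simp
              ring
            have h3 : 0 ≤ (v x - m) ^ 2 / (v x * m ^ 2) := by positivity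
            linarith
      _ = (∫⁻ x, ENNReal.ofReal (1 / v x) ∂μ) +
            ENNReal.ofReal (1 / m ^ 2) * ∫⁻ x, ENNReal.ofReal (v x) ∂μ := by
          rw [lintegral_add_left (by fun_prop), lintegral_const_mul _ (by fun_prop)]
      _ ≤ (∫⁻ x, ENNReal.ofReal (1 / v x) ∂μ) +
            ENNReal.ofReal (1 / m ^ 2) * ENNReal.ofReal (L * m) := by gcongr
      _ = _ := by
          rw [← ENNReal.ofReal_mul (by positivity)]
          congr 2
          field_simp
  exact (ENNReal.add_le_add_iff_right ENNReal.ofReal_ne_top).1 h1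

/-- The logarithm, unbounded as `ε → 0`, is what a finite `B_2` characteristic contradicts. -/
lemma lintegral_div_add_ge {l ε A : ℝ} (hl : 0 < l) (hε : 0 < ε) (hA : 0 ≤ A) :
    ENNReal.ofReal (A * l * Real.log (1 + 1 / (2 * ε))) ≤
      ∫⁻ r in Set.Ioo (1 - l / 2) 1, ENNReal.ofReal (A / (ε + (1 - r) / l)) := by
  have hle : 1 - l / 2 ≤ 1 := by linarith
  have hne : ∀ r ∈ Set.Icc (1 - l / 2) 1, 0 < ε + (1 - r) / l := fun r hr ↦ by
    have : 0 ≤ (1 - r) / l := div_nonneg (by linarith [hr.2]) hl.le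
    linarith
  have hc : ContinuousOn (fun r : ℝ ↦ A / (ε + (1 - r) / l)) (Set.Icc (1 - l / 2) 1) :=
    ContinuousOn.div (by fun_prop) (by fun_prop) fun r hr ↦ (hne r hr).ne'
  have hd : ∀ r ∈ Set.uIcc (1 - l / 2) 1, HasDerivAt
      (fun r : ℝ ↦ -(A * l) * Real.log (ε + (1 - r) / l)) (A / (ε + (1 - r) / l)) r := by
    intro r hr
    rw [Set.uIcc_of_le hle] at hr
    have h := hne r hr
    refine HasDerivAt.congr_deriv ((((((hasDerivAt_id r).const_sub 1).div_const l).const_add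
      ε).log h.ne').const_mul _) ?_
    simp only [id_eq]
    field_simp
  rw [setLIntegral_congr Ioo_ae_eq_Ioc, ← ofReal_integral_eq_lintegral_ofReal
    (hc.integrableOn_Icc.mono_set Set.Ioc_subset_Icc_self),
    ← intervalIntegral.integral_of_le hle, intervalIntegral.integral_eq_sub_of_hasDerivAt hd]
  · refine ENNReal.ofReal_le_ofReal (le_of_eq ?_)
    have h1 : 1 + 1 / (2 * ε) = (ε + (1 - (1 - l / 2)) / l) / (ε + (1 - 1) / l) := by
      field_simp
      ring
    rw [h1, Real.log_div (hne _ (by simp; linarith)).ne' (hne _ (by simp; linarith)).ne']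
    ring
  · exact (hc.mono (by rw [Set.uIcc_of_le hle])).intervalIntegrable
  · filter_upwards [ae_restrict_mem measurableSet_Ioc] with r hr
    exact div_nonneg hA (hne r ⟨hr.1.le, hr.2⟩).le

/-- Only the layer `l/4 < 1 - r < l/2` is used: there `u(z_I) ≤ 288 u`, with `288 = 8 * (1 + 5)²`.
-/
lemma lintegral_poissonIntegral_carlesonBox_ge (σ : Measure Circle) [IsFiniteMeasure σ]
    (ξ : Circle) {l : ℝ} (hl0 : 0 < l) (hl1 : l ≤ 1) :
    ENNReal.ofReal (Real.pi * l ^ 2 / 1152 * poissonIntegral σ (((1 - l : ℝ) : ℂ) * ξ)) ≤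
      ∫⁻ z in carlesonBox (openArc ξ l) l, ENNReal.ofReal (poissonIntegral σ z) := by
  have hpi := Real.pi_pos
  have hpi4 := Real.pi_lt_four
  set U := poissonIntegral σ (((1 - l : ℝ) : ℂ) * ξ)
  refine le_trans ?_ (lintegral_carlesonBox_ge ξ (a := 1 - l / 2) (b := 1 - l / 4) hl1
    (by linarith) (by linarith) (by linarith) le_rfl _)
  have hlow : ∀ p ∈ Set.Ioo (1 - l / 2) (1 - l / 4) ×ˢ Set.Ioo (-(Real.pi * l)) (Real.pi * l),
      ENNReal.ofReal (U / 288) ≤ ENNReal.ofReal (poissonIntegral σ (polarPoint ξ p)) := by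
    rintro ⟨r, t⟩ ⟨⟨hr1, hr2⟩, ht⟩
    simp only at hr1 hr2 ht
    have ht' := (abs_lt.2 ht).le
    refine ENNReal.ofReal_le_ofReal ?_
    have hn : ‖polarPoint ξ (r, t)‖ = r := norm_polarPoint ξ (by simp only; linarith)
    have hn' : ‖((1 - l : ℝ) : ℂ) * ξ‖ = 1 - l := norm_ofReal_mul_circle (by linarith) ξ
    have hdist : ‖((1 - l : ℝ) : ℂ) * ξ - polarPoint ξ (r, t)‖ ≤ 5 * l := by
      have h3 : ((1 - l : ℝ) : ℂ) * ξ - polarPoint ξ (r, t) =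
          -((r : ℂ) * (((ξ * Circle.exp t : Circle) : ℂ) - ξ) + ((r - (1 - l) : ℝ) : ℂ) * ξ) := by
        simp only [polarPoint]; push_cast; ring
      have h4 := norm_circle_mul_exp_sub_le ξ t
      calc _ ≤ ‖(r : ℂ) * (((ξ * Circle.exp t : Circle) : ℂ) - ξ)‖ +
            ‖((r - (1 - l) : ℝ) : ℂ) * ξ‖ := by rw [h3, norm_neg]; exact norm_add_le _ _
        _ ≤ 1 * |t| + (r - (1 - l)) := by
            rw [norm_ofReal_mul_circle (by linarith), norm_mul, Complex.norm_real,
              Real.norm_of_nonneg (by linarith)]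
            gcongr
            linarith
        _ ≤ 5 * l := by nlinarith
    have h := poissonIntegral_le_mul σ (M := 8) (K := 5) (z := ((1 - l : ℝ) : ℂ) * ξ)
      (w := polarPoint ξ (r, t)) (by rw [hn']; linarith) (by rw [hn]; linarith)
      (by rw [hn, hn']; nlinarith) (by rw [hn']; linarith)
    change U ≤ _ at h
    linarith
  calc ENNReal.ofReal (Real.pi * l ^ 2 / 1152 * U)
      = 2⁻¹ * ∫⁻ _ in Set.Ioo (1 - l / 2) (1 - l / 4) ×ˢ Set.Ioo (-(Real.pi * l)) (Real.pi * l),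
          ENNReal.ofReal (U / 288) := by
        rw [setLIntegral_const, Measure.volume_eq_prod, Measure.prod_prod, Real.volume_Ioo,
          Real.volume_Ioo, ← ENNReal.ofReal_mul (by linarith), ← ENNReal.ofReal_ofNat,
          ← ENNReal.ofReal_inv_of_pos two_pos, mul_comm (ENNReal.ofReal (U / 288)),
          ← ENNReal.ofReal_mul (mul_nonneg (by linarith) (by nlinarith)),
          ← ENNReal.ofReal_mul (by norm_num)]
        congr 1
        ring
    _ ≤ _ := mul_le_mul_right (setLIntegral_mono'
        (measurableSet_Ioo.prod measurableSet_Ioo) hlow) _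

lemma lintegral_inv_poissonIntegral_carlesonBox_ge (σ : Measure Circle) [IsFiniteMeasure σ]
    (hu : ∀ z : ℂ, ‖z‖ < 1 → 0 < poissonIntegral σ z)
    (ξ : Circle) {l ε : ℝ} (hl0 : 0 < l) (hl1 : l ≤ 1) (hε : 0 < ε)
    (hσ : σ.real (closedArc ξ (l / 2)) ≤ ε * l * poissonIntegral σ (((1 - l : ℝ) : ℂ) * ξ)) :
    ENNReal.ofReal (Real.pi * l ^ 2 / (648 * poissonIntegral σ (((1 - l : ℝ) : ℂ) * ξ)) *
        Real.log (1 + 1 / (2 * ε))) ≤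
      ∫⁻ z in carlesonBox (openArc ξ l) l, ENNReal.ofReal (1 / poissonIntegral σ z) := by
  have hpi := Real.pi_pos
  have hU0 : 0 < poissonIntegral σ (((1 - l : ℝ) : ℂ) * ξ) :=
    hu _ (by rw [norm_ofReal_mul_circle (by linarith)]; linarith)
  set U := poissonIntegral σ (((1 - l : ℝ) : ℂ) * ξ)
  refine le_trans ?_ (lintegral_carlesonBox_ge ξ (a := 1 - l / 2) (b := 1)
    (L := Real.pi * l / 4) hl1 (by linarith) (by linarith) le_rfl (by nlinarith) _)
  have hmeas : Measurable fun p : ℝ × ℝ ↦ ENNReal.ofReal (1 / poissonIntegral σ (polarPoint ξ p)) :=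
    (((measurable_poissonIntegral σ).comp (measurable_polarPoint ξ)).const_div 1).ennreal_ofReal
  have hinner : ∀ r ∈ Set.Ioo (1 - l / 2) 1,
      ENNReal.ofReal (Real.pi * l / (324 * U) / (ε + (1 - r) / l)) ≤
        ∫⁻ θ in Set.Ioo (-(Real.pi * l / 4)) (Real.pi * l / 4),
          ENNReal.ofReal (1 / poissonIntegral σ (polarPoint ξ (r, θ))) := by
    rintro r ⟨hr1, hr2⟩
    have hd : 0 < ε + (1 - r) / l := by
      have : 0 < (1 - r) / l := div_pos (by linarith) hl0
      linarith
    have hv : Measurable fun θ : ℝ ↦ poissonIntegral σ (polarPoint ξ (r, θ)) :=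
      (measurable_poissonIntegral σ).comp
        ((measurable_polarPoint ξ).comp (measurable_const.prodMk measurable_id))
    -- The value of `m` is chosen so that `L * m` equals `81π(εlU + (1 - r)U)`, which dominates the
    -- angular integral of `u` once `hσ` is inserted.
    have h := lintegral_ofReal_inv_ge
      (μ := volume.restrict (Set.Ioo (-(Real.pi * l / 4)) (Real.pi * l / 4))) hv
      (fun θ ↦ hu _ (by rw [norm_polarPoint ξ (by simp only; linarith)]; exact hr2))
      (L := Real.pi * l / 2) (m := 162 * U * (ε + (1 - r) / l)) (by positivity) (by positivity)
      (by rw [Measure.restrict_apply_univ, Real.volume_Ioo]; congr 1; ring)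
      ((lintegral_poissonIntegral_polarPoint_le σ ξ hl0 hl1 (by linarith) hr2).trans
        (ENNReal.ofReal_le_ofReal ?_))
    · refine le_trans (ENNReal.ofReal_le_ofReal (le_of_eq ?_)) h
      field_simp
      ring
    · have h1 : Real.pi * l / 2 * (162 * U * (ε + (1 - r) / l)) =
          81 * Real.pi * (ε * l * U) + 81 * Real.pi * (1 - r) * U := by
        field_simp
        ring
      rw [h1]
      have h2 : 0 ≤ ε * l * U := by positivity
      have h3 : 2 * Real.pi * σ.real (closedArc ξ (l / 2)) ≤ 2 * Real.pi * (ε * l * U) := by gcongr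
      nlinarith [mul_nonneg hpi.le h2]
  calc _ = 2⁻¹ * ENNReal.ofReal (Real.pi * l / (324 * U) * l * Real.log (1 + 1 / (2 * ε))) := by
        rw [← ENNReal.ofReal_ofNat, ← ENNReal.ofReal_inv_of_pos two_pos,
          ← ENNReal.ofReal_mul (by norm_num)]
        congr 1
        field_simp
        ring
    _ ≤ 2⁻¹ * ∫⁻ r in Set.Ioo (1 - l / 2) 1,
          ENNReal.ofReal (Real.pi * l / (324 * U) / (ε + (1 - r) / l)) := by
        gcongr
        exact lintegral_div_add_ge hl0 hε (by positivity)
    _ ≤ _ := by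
        gcongr
        rw [Measure.volume_eq_prod, setLIntegral_prod _ hmeas.aemeasurable]
        exact setLIntegral_mono' measurableSet_Ioo hinner

lemma closedArc_half_subset_openArc (ξ : Circle) {l : ℝ} (hl : 0 < l) :
    closedArc ξ (l / 2) ⊆ openArc ξ l :=
  Set.image_mono (Set.Icc_subset_Ioo (by linarith) (by linarith))

lemma exists_arc_le_of_bekolleBonamiB2_lt_top {σ : Measure Circle} [IsFiniteMeasure σ]
    (hu : ∀ z : ℂ, ‖z‖ < 1 → 0 < poissonIntegral σ z)
    (h : bekolleBonamiB2 (poissonIntegral σ) < ⊤) :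
    ∃ c : ℝ, 0 < c ∧ ∀ (I : Set Circle) (ξ : Circle) (l : ℝ), IsArc I ξ l →
      c * poissonIntegral σ (((1 - l : ℝ) : ℂ) * (ξ : ℂ)) ≤ σ.real I / l := by
  have hpi := Real.pi_pos
  set K := (bekolleBonamiB2 (poissonIntegral σ)).toReal with hK
  -- `2985984 = (2 * 1152) * (2 * 648)` collects the constants of the two lower bounds and of the
  -- area bound `2πl²`. With `ε = exp(-N)/2` the logarithm is at least `N`, so the product of
  -- averages would be at least `K + 1`.
  set N : ℝ := 2985984 * (K + 1) with hN
  have hK0 : 0 ≤ K := ENNReal.toReal_nonneg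
  refine ⟨Real.exp (-N) / 2, by positivity, fun I ξ l hI ↦ ?_⟩
  obtain ⟨hl0, hl1, hI1, -⟩ := hI
  have hU0 : 0 < poissonIntegral σ (((1 - l : ℝ) : ℂ) * ξ) :=
    hu _ (by rw [norm_ofReal_mul_circle (by linarith)]; linarith)
  by_contra! hlt
  rw [div_lt_iff₀ hl0] at hlt
  have hsmall : σ.real (closedArc ξ (l / 2)) ≤
      Real.exp (-N) / 2 * l * poissonIntegral σ (((1 - l : ℝ) : ℂ) * ξ) := by
    have := measureReal_mono (μ := σ) ((closedArc_half_subset_openArc ξ hl0).trans hI1)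
    linarith
  have h1 := lintegral_poissonIntegral_carlesonBox_ge σ ξ hl0 hl1
  have h2 := lintegral_inv_poissonIntegral_carlesonBox_ge σ hu ξ hl0 hl1 (by positivity) hsmall
  set U := poissonIntegral σ (((1 - l : ℝ) : ℂ) * ξ)
  have hlog : N ≤ Real.log (1 + 1 / (2 * (Real.exp (-N) / 2))) := by
    rw [Real.le_log_iff_exp_le (by positivity), mul_div_cancel₀ _ two_ne_zero, one_div,
      Real.exp_neg, inv_inv]
    linarith
  have hsub := carlesonBox_mono (openArc_subset_closedArc ξ l) l
  have h3 := h1.trans (lintegral_mono_set hsub)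
  have h4 := h2.trans (lintegral_mono_set hsub)
  have hV := volume_carlesonBox_le ξ hl0 hl1
  have hB : ((discArea (carlesonBox (closedArc ξ l) l))⁻¹ *
        ∫⁻ z in carlesonBox (closedArc ξ l) l, ENNReal.ofReal (poissonIntegral σ z) ∂discArea) *
      ((discArea (carlesonBox (closedArc ξ l) l))⁻¹ *
        ∫⁻ z in carlesonBox (closedArc ξ l) l,
          ENNReal.ofReal (1 / poissonIntegral σ z) ∂discArea) ≤
      bekolleBonamiB2 (poissonIntegral σ) :=
    le_iSup₂_of_le (closedArc ξ l) ξ (le_iSup₂_of_le l (isArc_closedArc ξ hl0 hl1) le_rfl)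
  rw [discArea_average (carlesonBox_subset_ball _ _),
    discArea_average (carlesonBox_subset_ball _ _), ← ENNReal.ofReal_toReal h.ne, ← hK] at hB
  have hcontra : ENNReal.ofReal (K + 1) ≤ ENNReal.ofReal K := by
    refine le_trans ?_ hB
    calc ENNReal.ofReal (K + 1)
        = ((ENNReal.ofReal (2 * Real.pi * l ^ 2))⁻¹ *
            ENNReal.ofReal (Real.pi * l ^ 2 / 1152 * U)) *
          ((ENNReal.ofReal (2 * Real.pi * l ^ 2))⁻¹ *
            ENNReal.ofReal (Real.pi * l ^ 2 / (648 * U) * N)) := by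
          rw [← ENNReal.ofReal_inv_of_pos (by positivity), ← ENNReal.ofReal_mul (by positivity),
            ← ENNReal.ofReal_mul (by positivity), ← ENNReal.ofReal_mul (by positivity)]
          congr 1
          rw [hN]
          field_simp
          ring
      _ ≤ _ := by
          gcongr
          refine le_trans (ENNReal.ofReal_le_ofReal ?_) h4
          gcongr
  rw [ENNReal.ofReal_le_ofReal_iff hK0] at hcontra
  linarith

theorem mainTheorem1 (f : ℂ → ℂ) (hf : DifferentiableOn ℂ f (ball (0 : ℂ) 1))
    (hmaps : Set.MapsTo f (ball (0 : ℂ) 1) (ball (0 : ℂ) 1))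
    (σ : Measure Circle) (hσ : IsAleksandrovClarkMeasure f σ) :
    List.TFAE [
      IsContractive f,
      ∃ c : ℝ, 0 < c ∧ ∀ (I : Set Circle) (ξ : Circle) (l : ℝ), IsArc I ξ l →
        c * poissonIntegral σ (((1 - l : ℝ) : ℂ) * (ξ : ℂ)) ≤ σ.real I / l,
      bekolleBonamiB2 (poissonIntegral σ) < ⊤] := by
  have := hσ.1
  tfae_have 1 → 3 := bekolleBonamiB2_lt_top_of_isContractive hf hmaps hσ
  tfae_have 3 → 2 := exists_arc_le_of_bekolleBonamiB2_lt_top fun z hz ↦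
    (hσ.pos_and_hyperbolicDeriv_eq hf hmaps hz).1
  tfae_have 2 → 1 := fun ⟨_, hc, h⟩ ↦ isContractive_of_arc_le hf hmaps hσ hc h
  tfae_finish
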